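/- A planted plane tree is a finite rooted tree in which every node may have any finite number of children and the children of each node are linearly ordered from left to right; trees are regarded as posets under the ancestor order. Let $\mathcal{T}_n$ be the finite family of all planted plane trees with $n$ nodes. An embedding of a planted plane tree $S$ into a planted plane tree $T$ is a subposet of $T$ (a set of nodes of $T$ with the induced ancestor order) that is isomorphic to $S$ by an isomorphism which preserves the left-to-right order of the children of each node of $S$; it is good if it contains the root of $T$. Write $S\subseteq T$ if there is at least one embedding of $S$ into $T$. Let $a_T(S)$ and $g_T(S)$ be the numbers of all and of good embeddings of $S$ into $T$, and put $a_{\mathcal{T}_n}(S)=\sum_{T\in\mathcal{T}_n}a_T(S)$ and $g_{\mathcal{T}_n}(S)=\sum_{T\in\mathcal{T}_n}g_T(S)$. Theorem. (i) Let $S$ be a planted plane tree with $m$ nodes and $l$ leaves (nodes without children), and let $k=\frac{m+l-2}{2}$. If $m>1$, then $$\lim_{n\to\infty}\sqrt n\,\frac{g_{\mathcal{T}_n}(S)}{a_{\mathcal{T}_n}(S)}=\frac{2\,\Gamma(k+1/2)}{\Gamma(k)},$$ and if $m=1$, then this limit exists and equals $0$. (ii) If $S_1,S_2$ are planted plane trees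 with $S_1\subseteq S_2$, then both of the following limits exist and $$\lim_{n\to\infty}\sqrt n\,\frac{g_{\mathcal{T}_n}(S_1)}{a_{\mathcal{T}_n}(S_1)}\le\lim_{n\to\infty}\sqrt n\,\frac{g_{\mathcal{T}_n}(S_2)}{a_{\mathcal{T}_n}(S_2)}.$$ -/

import Mathlib

open Filter Topology

/-- Planted plane trees: a root together with the left-to-right list of the subtrees attached to
it. -/
inductive PlaneTree : Type where
  | node (children : List PlaneTree) : PlaneTree

namespace PlaneTree

/-- The number of nodes of a tree. -/
def size : PlaneTree → ℕ
  | node ts => 1 + (ts.map size).sum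

/-- The number of leaves (nodes without children) of a tree. -/
def leaves : PlaneTree → ℕ
  | node [] => 1
  | node (t :: ts) => leaves t + (ts.map leaves).sum

/-- The nodes of a tree are named by their addresses: the root is `[]`, and `i :: p` is the node
with address `p` in the `i`-th subtree (from the left, counting from `0`) of the root. -/
def IsNode : PlaneTree → List ℕ → Prop
  | _, [] => True
  | node ts, i :: p => ∃ h : i < ts.length, IsNode ts[i] p

/-- The type of nodes of `T`. -/
def Node (T : PlaneTree) : Type := {p : List ℕ // T.IsNode p}

/-- The root of `T`. -/
def root (T : PlaneTree) : T.Node := ⟨[], by cases T; trivial⟩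

/-- The tree poset: `u` is `v` or an ancestor of `v`. -/
def Node.AncestorEq {T : PlaneTree} (u v : T.Node) : Prop := u.1 <+: v.1

/-- The node `u` lies to the left of the node `v`: the two nodes lie in the subtrees of two
different children of a common ancestor, that of `u` being further left. -/
def Node.LeftOf {T : PlaneTree} (u v : T.Node) : Prop :=
  ∃ (r : List ℕ) (i j : ℕ) (p q : List ℕ), i < j ∧ u.1 = r ++ i :: p ∧ v.1 = r ++ j :: q

/-- `v` is a child of `u`. -/
def Node.IsChild {T : PlaneTree} (u v : T.Node) : Prop := ∃ i : ℕ, v.1 = u.1 ++ [i]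

/-- `φ` is an isomorphism of posets from `S` onto a subposet of `T` that keeps the left-to-right
order of the children of each node of `S`. -/
structure IsPlaneEmbedding {S T : PlaneTree} (φ : S.Node → T.Node) : Prop where
  ancestorEq_iff : ∀ u v : S.Node, (φ u).AncestorEq (φ v) ↔ u.AncestorEq v
  children_leftOf : ∀ w u v : S.Node, w.IsChild u → w.IsChild v → u.LeftOf v →
    (φ u).LeftOf (φ v)

/-- The embeddings of `S` into `T`, each one given by the set of nodes of `T` that it occupies. -/
def embeddings (S T : PlaneTree) : Set (Set T.Node) :=
  {X | ∃ φ : S.Node → T.Node, IsPlaneEmbedding φ ∧ Set.range φ = X}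

/-- The good embeddings of `S` into `T`: those that contain the root of `T`. -/
def goodEmbeddings (S T : PlaneTree) : Set (Set T.Node) :=
  {X | X ∈ embeddings S T ∧ T.root ∈ X}

/-- There is at least one embedding of `S` into `T`. -/
def Embeds (S T : PlaneTree) : Prop := (embeddings S T).Nonempty

/-- A tree has finitely many nodes, so the cardinalities below are those of finite sets. -/
instance finite_node : ∀ T : PlaneTree, Finite T.Node
  | node ts => by
    have ih : ∀ i : Fin ts.length, Finite (ts[i]).Node := fun i => finite_node ts[i]
    let f : Option (Σ i : Fin ts.length, (ts[i]).Node) → (node ts).Node := fun x =>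
      match x with
      | none => (node ts).root
      | some ⟨i, v⟩ => ⟨i.1 :: v.1, ⟨i.2, v.2⟩⟩
    refine Finite.of_surjective f ?_
    rintro ⟨p, hp⟩
    cases p with
    | nil => exact ⟨none, rfl⟩
    | cons i p =>
      obtain ⟨h, hp⟩ := hp
      exact ⟨some ⟨⟨i, h⟩, ⟨p, hp⟩⟩, rfl⟩
  termination_by T => sizeOf T
  decreasing_by
    have := List.sizeOf_lt_of_mem (List.getElem_mem i.2)
    simp only [PlaneTree.node.sizeOf_spec, Fin.getElem_fin]
    omega

/-- The number `a_T(S)` of all embeddings of `S` into `T`. -/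
noncomputable def numEmb (S T : PlaneTree) : ℕ := (embeddings S T).ncard

/-- The number `g_T(S)` of good embeddings of `S` into `T`. -/
noncomputable def numGoodEmb (S T : PlaneTree) : ℕ := (goodEmbeddings S T).ncard

theorem size_pos (T : PlaneTree) : 0 < T.size := by
  cases T; rw [size]; omega

theorem length_le_sum_size (ts : List PlaneTree) : ts.length ≤ (ts.map size).sum := by
  induction ts with
  | nil => simp
  | cons t ts ih =>
    have := size_pos t
    simp only [List.length_cons, List.map_cons, List.sum_cons]
    omega

theorem finite_size_le (n : ℕ) : {T : PlaneTree | T.size ≤ n}.Finite := by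
  induction n with
  | zero =>
    refine Set.finite_empty.subset fun T hT => ?_
    have := size_pos T
    simp only [Set.mem_ofPred_eq] at hT
    omega
  | succ n ih =>
    have : Finite {T : PlaneTree | T.size ≤ n} := ih
    refine ((List.finite_length_le {T : PlaneTree | T.size ≤ n} n).image
      (fun l => node (l.map Subtype.val))).subset ?_
    rintro ⟨ts⟩ hT
    simp only [Set.mem_ofPred_eq, size] at hT
    have hmem : ∀ t ∈ ts, t.size ≤ n := fun t ht => by
      have := List.le_sum_of_mem (List.mem_map_of_mem (f := size) ht)
      omega
    refine ⟨ts.attach.map fun t => ⟨t.1, hmem t.1 t.2⟩, ?_, ?_⟩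
    · have := length_le_sum_size ts
      simp only [Set.mem_ofPred_eq, List.length_map, List.length_attach]
      omega
    · simp [Function.comp_def]

/-- The family `𝒯ₙ` of all planted plane trees with `n` nodes. -/
noncomputable def family (n : ℕ) : Finset PlaneTree :=
  Set.Finite.toFinset (s := {T : PlaneTree | T.size = n})
    ((finite_size_le n).subset fun _ hT => le_of_eq hT)

/-- The cumulative number of all embeddings of `S` into the members of `𝒯ₙ`. -/
noncomputable def familyNumEmb (n : ℕ) (S : PlaneTree) : ℕ := ∑ T ∈ family n, numEmb S T

/-- The cumulative number of good embeddings of `S` into the members of `𝒯ₙ`. -/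
noncomputable def familyNumGoodEmb (n : ℕ) (S : PlaneTree) : ℕ := ∑ T ∈ family n, numGoodEmb S T

/-- The sequence `√n * g(S) / a(S)` for the family `𝒯ₙ`. -/
noncomputable def scaledRatio (S : PlaneTree) (n : ℕ) : ℝ :=
  √(n : ℝ) * ((familyNumGoodEmb n S : ℝ) / (familyNumEmb n S : ℝ))

end PlaneTree

/-! Embeddings are counted for forests, since removing the root of `S = node ss` leaves the forest
`ss`, and a good embedding of `S` is the same as an embedding of `ss` avoiding the root of `T`.
Write F(σ) for the generating function of root-avoiding embeddings of σ into all trees. If `T` has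
first subtree `t` and remaining part `node τ`, such an embedding sends an initial segment of the
trees of σ into `t` and the others into `τ` (`properForestCount_node_cons`).

The two terms of this convolution in which all of σ goes to one side produce 2·T·F(σ), where T =
F([]) is the tree series. Moving them to the left leaves the factor s = 1 - 2T = √(1 - 4X)
(`sqrtSeries_mul_forestSeries`). Hence each F(σ) is a Laurent polynomial in s. With S having m nodes
and l leaves, induction gives F(ss) a pole of order e = m + l - 2 = 2k in s with leading coefficient
c > 0 (`exists_isSqrtLaurent_forestSeries`). The series of all embeddings of S is F(ss)(T + s)/s,
with pole order e + 1 and leading coefficient c/2.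

The n-th coefficient of s^(-j) is asymptotic to 4^n n^(j/2-1)/Γ(j/2) for j > 0
(`hasCoeffLimit_invSqrtSeries_pow`), so for e > 0 the scaled ratio tends to 2Γ((e+1)/2)/Γ(e/2), with
c cancelling. For m = 1 the ratio is exactly 1/n. Finally, m and l both grow under embedding, and
the limit is nondecreasing in e by log-convexity of Γ. -/

namespace PlaneTree

/-! ### Addresses: prefix order, left-to-right order, shifts -/

/-- The address `p` lies to the left of the address `q`. -/
def AddrLeftOf (p q : List ℕ) : Prop :=
  ∃ (r : List ℕ) (i j : ℕ) (p' q' : List ℕ), i < j ∧ p = r ++ i :: p' ∧ q = r ++ j :: q'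

/-- The addresses `p` and `q` have the same parent, and `p` is further left. -/
def AddrSibling (p q : List ℕ) : Prop :=
  ∃ (w : List ℕ) (i j : ℕ), i < j ∧ p = w ++ [i] ∧ q = w ++ [j]

/-- Move an address by `k` places to the right in a forest. -/
def shift (k : ℕ) : List ℕ → List ℕ
  | [] => []
  | i :: p => (i + k) :: p

theorem not_addrLeftOf_nil_left (q : List ℕ) : ¬ AddrLeftOf [] q := by
  rintro ⟨r, i, j, p', q', -, h, -⟩
  simp at h

theorem not_addrLeftOf_nil_right (p : List ℕ) : ¬ AddrLeftOf p [] := by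
  rintro ⟨r, i, j, p', q', -, -, h⟩
  simp at h

theorem addrLeftOf_cons_cons {a b : ℕ} {p q : List ℕ} :
    AddrLeftOf (a :: p) (b :: q) ↔ a < b ∨ a = b ∧ AddrLeftOf p q := by
  constructor
  · rintro ⟨r, i, j, p', q', hij, hp, hq⟩
    cases r with
    | nil => simp at hp hq; left; omega
    | cons c r =>
      simp at hp hq
      exact Or.inr ⟨by omega, r, i, j, p', q', hij, hp.2, hq.2⟩
  · rintro (h | ⟨rfl, r, i, j, p', q', hij, rfl, rfl⟩)
    · exact ⟨[], a, b, p, q, h, rfl, rfl⟩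
    · exact ⟨a :: r, i, j, p', q', hij, rfl, rfl⟩

theorem not_addrSibling_nil_left (q : List ℕ) : ¬ AddrSibling [] q := by
  rintro ⟨r, i, j, -, h, -⟩
  simp at h

theorem not_addrSibling_nil_right (p : List ℕ) : ¬ AddrSibling p [] := by
  rintro ⟨r, i, j, -, -, h⟩
  simp at h

theorem addrSibling_cons_cons {a b : ℕ} {p q : List ℕ} :
    AddrSibling (a :: p) (b :: q) ↔ (a < b ∧ p = [] ∧ q = []) ∨ (a = b ∧ AddrSibling p q) := by
  constructor
  · rintro ⟨r, i, j, hij, hp, hq⟩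
    cases r with
    | nil => simp at hp hq; left; exact ⟨by omega, hp.2, hq.2⟩
    | cons c r =>
      simp at hp hq
      exact Or.inr ⟨by omega, r, i, j, hij, hp.2, hq.2⟩
  · rintro (⟨h, rfl, rfl⟩ | ⟨rfl, r, i, j, hij, rfl, rfl⟩)
    · exact ⟨[], a, b, h, rfl, rfl⟩
    · exact ⟨a :: r, i, j, hij, rfl, rfl⟩

theorem shift_prefix_shift {k : ℕ} {p q : List ℕ} : shift k p <+: shift k q ↔ p <+: q := by
  cases p <;> cases q <;> simp [shift, List.cons_prefix_cons]

theorem addrLeftOf_shift_shift {k : ℕ} {p q : List ℕ} :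
    AddrLeftOf (shift k p) (shift k q) ↔ AddrLeftOf p q := by
  cases p <;> cases q <;>
    simp [shift, addrLeftOf_cons_cons, not_addrLeftOf_nil_left, not_addrLeftOf_nil_right]

theorem addrSibling_shift_shift {k : ℕ} {p q : List ℕ} :
    AddrSibling (shift k p) (shift k q) ↔ AddrSibling p q := by
  cases p <;> cases q <;>
    simp [shift, addrSibling_cons_cons, not_addrSibling_nil_left, not_addrSibling_nil_right]

theorem AddrSibling.addrLeftOf {p q : List ℕ} (h : AddrSibling p q) : AddrLeftOf p q := by
  obtain ⟨w, i, j, hij, rfl, rfl⟩ := h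
  exact ⟨w, i, j, [], [], hij, rfl, rfl⟩

/-- The addresses of the nodes of a forest, whose roots are `[0], [1], …`. -/
def forestNodes (σ : List PlaneTree) : Set (List ℕ) := {p | p ≠ [] ∧ (node σ).IsNode p}

theorem isNode_nil (T : PlaneTree) : T.IsNode [] := by cases T; trivial

theorem isNode_cons {σ : List PlaneTree} {i : ℕ} {p : List ℕ} :
    (node σ).IsNode (i :: p) ↔ ∃ h : i < σ.length, σ[i].IsNode p := Iff.rfl

theorem isNode_of_prefix {T : PlaneTree} {p q : List ℕ} (h : p <+: q) (hq : T.IsNode q) :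
    T.IsNode p := by
  induction p generalizing T q with
  | nil => exact isNode_nil T
  | cons i p ih =>
    obtain ⟨σ⟩ := T
    cases q with
    | nil => simp at h
    | cons j q =>
      obtain ⟨rfl, hpq⟩ := List.cons_prefix_cons.1 h
      obtain ⟨hi, hq⟩ := hq
      exact ⟨hi, ih hpq hq⟩

theorem nil_notMem_forestNodes (σ : List PlaneTree) : [] ∉ forestNodes σ := fun h => h.1 rfl

theorem cons_mem_forestNodes {σ : List PlaneTree} {i : ℕ} {p : List ℕ} :
    i :: p ∈ forestNodes σ ↔ ∃ h : i < σ.length, σ[i].IsNode p := by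
  simp [forestNodes, isNode_cons]

theorem mem_forestNodes_take {σ : List PlaneTree} {k i : ℕ} {p : List ℕ} :
    i :: p ∈ forestNodes (σ.take k) ↔ i < k ∧ i :: p ∈ forestNodes σ := by
  simp only [cons_mem_forestNodes, List.length_take, List.getElem_take]
  constructor
  · rintro ⟨h, h'⟩; exact ⟨by omega, by omega, h'⟩
  · rintro ⟨h, h', h''⟩; exact ⟨by omega, h''⟩

theorem mem_forestNodes_drop {σ : List PlaneTree} {k : ℕ} {p : List ℕ} :
    p ∈ forestNodes (σ.drop k) ↔ shift k p ∈ forestNodes σ := by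
  cases p with
  | nil => simp [shift, nil_notMem_forestNodes]
  | cons i p =>
    simp only [shift, cons_mem_forestNodes, List.length_drop, List.getElem_drop, add_comm i k]
    constructor
    · rintro ⟨h, h'⟩; exact ⟨by omega, h'⟩
    · rintro ⟨h, h'⟩; exact ⟨by omega, h'⟩

theorem singleton_mem_forestNodes {σ : List PlaneTree} {i : ℕ} {p : List ℕ}
    (h : i :: p ∈ forestNodes σ) : [i] ∈ forestNodes σ := by
  obtain ⟨h, -⟩ := cons_mem_forestNodes.1 h
  exact cons_mem_forestNodes.2 ⟨h, isNode_nil _⟩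

/-! ### Occurrences of a forest and their decomposition -/

/-- `φ` embeds the forest `σ` into the poset of all addresses. -/
structure IsForestMap (σ : List PlaneTree) (φ : List ℕ → List ℕ) : Prop where
  prefix_iff : ∀ u ∈ forestNodes σ, ∀ v ∈ forestNodes σ, (φ u <+: φ v ↔ u <+: v)
  leftOf : ∀ u ∈ forestNodes σ, ∀ v ∈ forestNodes σ, AddrSibling u v → AddrLeftOf (φ u) (φ v)

/-- The set `X` of addresses is the image of an embedding of the forest `σ`. -/
def Occurs (σ : List PlaneTree) (X : Set (List ℕ)) : Prop :=
  ∃ φ, IsForestMap σ φ ∧ φ '' forestNodes σ = X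

theorem exists_threshold (P : ℕ → Prop) (r : ℕ) (hP : ∀ i j, i < j → j < r → P j → P i) :
    ∃ k ≤ r, ∀ j < r, j < k ↔ P j := by
  classical
  by_cases h : ∃ j, j < r ∧ ¬ P j
  · refine ⟨Nat.find h, (Nat.find_spec h).1.le, fun j hj => ⟨fun hk => ?_, fun hp => ?_⟩⟩
    · by_contra hn
      exact Nat.find_min h hk ⟨hj, hn⟩
    · by_contra hn
      rcases (not_lt.1 hn).lt_or_eq with hlt | heq
      · exact (Nat.find_spec h).2 (hP _ _ hlt hj hp)
      · exact (Nat.find_spec h).2 (heq ▸ hp)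
  · push Not at h
    exact ⟨r, le_rfl, fun j hj => ⟨fun _ => h j hj, fun _ => hj⟩⟩

/-- A whole tree of σ stays inside the subtree of `T` that receives its root. As the roots of σ keep
their left-to-right order, those landing in subtree 0 form an initial segment, whose length is `k`.
-/
theorem Occurs.exists_split {σ : List PlaneTree} {X : Set (List ℕ)} (hX : [] ∉ X)
    (h : Occurs σ X) : ∃ k ≤ σ.length,
      Occurs (σ.take k) (List.cons 0 ⁻¹' X) ∧ Occurs (σ.drop k) (shift 1 ⁻¹' X) := by
  obtain ⟨φ, hφ, rfl⟩ := h
  have hne : ∀ u ∈ forestNodes σ, φ u ≠ [] := fun u hu h0 => hX ⟨u, hu, h0⟩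
  -- The predicate says that the root of the `j`-th tree is sent into subtree 0.
  obtain ⟨k, hk, hkφ⟩ := exists_threshold (fun j => (φ [j]).head? = some 0) σ.length (by
    intro i j hij hj hpj
    have hi' : [i] ∈ forestNodes σ := cons_mem_forestNodes.2 ⟨by omega, isNode_nil _⟩
    have hj' : [j] ∈ forestNodes σ := cons_mem_forestNodes.2 ⟨by omega, isNode_nil _⟩
    have hl := hφ.leftOf _ hi' _ hj' ⟨[], i, j, hij, rfl, rfl⟩
    cases hi : φ [i] with
    | nil => exact absurd hi (hne _ hi')
    | cons a p =>
      cases hjj : φ [j] with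
      | nil => exact absurd hjj (hne _ hj')
      | cons b q =>
        rw [hi, hjj, addrLeftOf_cons_cons] at hl
        rw [hjj] at hpj
        simp at hpj ⊢
        omega)
  have key : ∀ j p, j :: p ∈ forestNodes σ → ∃ a q, φ (j :: p) = a :: q ∧ (j < k ↔ a = 0) := by
    intro j p hu
    have hj' := singleton_mem_forestNodes hu
    obtain ⟨hj, -⟩ := cons_mem_forestNodes.1 hu
    have hpre := (hφ.prefix_iff _ hj' _ hu).2 (by simp)
    cases hjj : φ [j] with
    | nil => exact absurd hjj (hne _ hj')
    | cons b q =>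
      rw [hjj] at hpre
      obtain ⟨t, ht⟩ := hpre
      exact ⟨b, q ++ t, by rw [← ht]; rfl, by rw [hkφ j hj, hjj]; simp⟩
  refine ⟨k, hk, ?_, ?_⟩
  · have hs : ∀ u ∈ forestNodes (σ.take k), u ∈ forestNodes σ ∧ 0 :: (φ u).tail = φ u := by
      intro u hu
      cases u with
      | nil => exact absurd hu (nil_notMem_forestNodes _)
      | cons j p =>
        obtain ⟨hj, hu⟩ := mem_forestNodes_take.1 hu
        obtain ⟨a, q, h1, h2⟩ := key j p hu
        refine ⟨hu, ?_⟩
        rw [h1, h2.1 hj]; rfl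
    refine ⟨fun u => (φ u).tail, ⟨fun u hu v hv => ?_, fun u hu v hv huv => ?_⟩, ?_⟩
    · rw [← hφ.prefix_iff u (hs u hu).1 v (hs v hv).1, ← (hs u hu).2, ← (hs v hv).2,
        List.cons_prefix_cons]
      simp
    · have := hφ.leftOf u (hs u hu).1 v (hs v hv).1 huv
      rw [← (hs u hu).2, ← (hs v hv).2, addrLeftOf_cons_cons] at this
      simpa using this
    · ext x
      simp only [Set.mem_image, Set.mem_preimage]
      constructor
      · rintro ⟨u, hu, rfl⟩
        exact ⟨u, (hs u hu).1, (hs u hu).2.symm⟩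
      · rintro ⟨u, hu, hx⟩
        cases u with
        | nil => exact absurd hu (nil_notMem_forestNodes _)
        | cons j p =>
          obtain ⟨a, q, h1, h2⟩ := key j p hu
          rw [h1] at hx
          simp only [List.cons.injEq] at hx
          exact ⟨j :: p, mem_forestNodes_take.2 ⟨h2.2 hx.1, hu⟩, by rw [h1]; exact hx.2⟩
  · have hs : ∀ u, ∃ y, u ∈ forestNodes (σ.drop k) → shift 1 y = φ (shift k u) := by
      intro u
      by_cases hu : u ∈ forestNodes (σ.drop k)
      · cases u with
        | nil => exact absurd hu (nil_notMem_forestNodes _)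
        | cons j p =>
          obtain ⟨a, q, h1, h2⟩ := key _ p (mem_forestNodes_drop.1 hu)
          -- Here `a ≠ 0`, because the tree index is at least `k`; the subtraction is not truncated.
          refine ⟨(a - 1) :: q, fun _ => ?_⟩
          rw [shift, shift, h1]
          congr 1
          omega
      · exact ⟨[], fun h => absurd h hu⟩
    choose ψ hψ using hs
    have hd : ∀ u ∈ forestNodes (σ.drop k), shift k u ∈ forestNodes σ :=
      fun u hu => mem_forestNodes_drop.1 hu
    refine ⟨ψ, ⟨fun u hu v hv => ?_, fun u hu v hv huv => ?_⟩, ?_⟩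
    · rw [← shift_prefix_shift (k := 1), hψ u hu, hψ v hv, hφ.prefix_iff _ (hd u hu) _ (hd v hv),
        shift_prefix_shift]
    · rw [← addrLeftOf_shift_shift (k := 1), hψ u hu, hψ v hv]
      exact hφ.leftOf _ (hd u hu) _ (hd v hv) (addrSibling_shift_shift.2 huv)
    · ext x
      simp only [Set.mem_image, Set.mem_preimage]
      constructor
      · rintro ⟨u, hu, rfl⟩
        exact ⟨_, hd u hu, (hψ u hu).symm⟩
      · rintro ⟨u, hu, hx⟩
        cases u with
        | nil => exact absurd hu (nil_notMem_forestNodes _)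
        | cons j p =>
          obtain ⟨a, q, h1, h2⟩ := key j p hu
          cases x with
          | nil => rw [h1] at hx; simp [shift] at hx
          | cons b x =>
            have hx' := hx
            rw [h1] at hx
            simp only [shift, List.cons.injEq] at hx
            have hj : k ≤ j := by
              by_contra hn
              have := h2.1 (by omega)
              omega
            have hjs : shift k ((j - k) :: p) = j :: p := by
              rw [shift, Nat.sub_add_cancel hj]
            have hm : (j - k) :: p ∈ forestNodes (σ.drop k) := by
              rw [mem_forestNodes_drop, hjs]; exact hu
            refine ⟨(j - k) :: p, hm, ?_⟩
            have h3 := hψ _ hm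
            rw [hjs, hx'] at h3
            cases hy : ψ ((j - k) :: p) with
            | nil => rw [hy] at h3; simp [shift] at h3
            | cons c y =>
              rw [hy] at h3
              simp only [shift, List.cons.injEq] at h3
              rw [h3.2]
              congr 1
              omega

/-- Gluing works because no order condition links the two parts except between roots, and every
address in subtree 0 is left of and incomparable to every address in the later subtrees. -/
theorem Occurs.of_split {σ : List PlaneTree} {X : Set (List ℕ)} (hX : [] ∉ X) {k : ℕ}
    (h0 : Occurs (σ.take k) (List.cons 0 ⁻¹' X)) (h1 : Occurs (σ.drop k) (shift 1 ⁻¹' X)) :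
    Occurs σ X := by
  obtain ⟨φ, hφ, hφX⟩ := h0
  obtain ⟨ψ, hψ, hψX⟩ := h1
  have hψne : ∀ u ∈ forestNodes (σ.drop k), ∃ b q, ψ u = b :: q := by
    intro u hu
    have : ψ u ∈ shift 1 ⁻¹' X := hψX ▸ ⟨u, hu, rfl⟩
    cases h : ψ u with
    | nil => rw [h] at this; exact absurd this hX
    | cons b q => exact ⟨b, q, rfl⟩
  let χ : List ℕ → List ℕ := fun u => if u.headD 0 < k then 0 :: φ u else
    shift 1 (ψ ((u.headD 0 - k) :: u.tail))
  have hχ0 : ∀ j p, j < k → χ (j :: p) = 0 :: φ (j :: p) := fun j p hj => by simp [χ, hj]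
  have hχ1 : ∀ u ∈ forestNodes (σ.drop k), χ (shift k u) = shift 1 (ψ u) := by
    intro u hu
    cases u with
    | nil => exact absurd hu (nil_notMem_forestNodes _)
    | cons j p => simp [χ, shift]
  have hcase : ∀ u ∈ forestNodes σ, (∃ j p, u = j :: p ∧ j < k ∧ u ∈ forestNodes (σ.take k)) ∨
      ∃ v ∈ forestNodes (σ.drop k), u = shift k v := by
    intro u hu
    cases u with
    | nil => exact absurd hu (nil_notMem_forestNodes _)
    | cons j p =>
      by_cases hj : j < k
      · exact Or.inl ⟨j, p, rfl, hj, mem_forestNodes_take.2 ⟨hj, hu⟩⟩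
      · have hjs : shift k ((j - k) :: p) = j :: p := by
          rw [shift, Nat.sub_add_cancel (by omega)]
        exact Or.inr ⟨(j - k) :: p, by rw [mem_forestNodes_drop, hjs]; exact hu, hjs.symm⟩
  refine ⟨χ, ⟨fun u hu v hv => ?_, fun u hu v hv huv => ?_⟩, ?_⟩
  · rcases hcase u hu with ⟨j, p, rfl, hj, hu'⟩ | ⟨u, hu', rfl⟩ <;>
      rcases hcase v hv with ⟨i, q, rfl, hi, hv'⟩ | ⟨v, hv', rfl⟩
    · rw [hχ0 _ _ hj, hχ0 _ _ hi, List.cons_prefix_cons, hφ.prefix_iff _ hu' _ hv']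
      simp
    · rw [hχ0 _ _ hj, hχ1 _ hv']
      obtain ⟨b, q, hb⟩ := hψne v hv'
      rw [hb]
      cases v with
      | nil => exact absurd hv' (nil_notMem_forestNodes _)
      | cons i q =>
        simp only [shift, List.cons_prefix_cons]
        omega
    · rw [hχ0 _ _ hi, hχ1 _ hu']
      obtain ⟨b, q, hb⟩ := hψne u hu'
      rw [hb]
      cases u with
      | nil => exact absurd hu' (nil_notMem_forestNodes _)
      | cons i q =>
        simp only [shift, List.cons_prefix_cons]
        omega
    · rw [hχ1 _ hu', hχ1 _ hv', shift_prefix_shift, shift_prefix_shift,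
        hψ.prefix_iff _ hu' _ hv']
  · rcases hcase u hu with ⟨j, p, rfl, hj, hu'⟩ | ⟨u, hu', rfl⟩ <;>
      rcases hcase v hv with ⟨i, q, rfl, hi, hv'⟩ | ⟨v, hv', rfl⟩
    · rw [hχ0 _ _ hj, hχ0 _ _ hi, addrLeftOf_cons_cons]
      exact Or.inr ⟨rfl, hφ.leftOf _ hu' _ hv' huv⟩
    · rw [hχ0 _ _ hj, hχ1 _ hv']
      obtain ⟨b, q, hb⟩ := hψne v hv'
      rw [hb, shift, addrLeftOf_cons_cons]
      left; omega
    · cases u with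
      | nil => exact absurd hu' (nil_notMem_forestNodes _)
      | cons a q =>
        simp only [shift, addrSibling_cons_cons] at huv
        omega
    · rw [hχ1 _ hu', hχ1 _ hv', addrLeftOf_shift_shift]
      exact hψ.leftOf _ hu' _ hv' (addrSibling_shift_shift.1 huv)
  · have e0 : ∀ x, x ∈ φ '' forestNodes (σ.take k) ↔ 0 :: x ∈ X := fun x => by rw [hφX]; rfl
    have e1 : ∀ x, x ∈ ψ '' forestNodes (σ.drop k) ↔ shift 1 x ∈ X := fun x => by rw [hψX]; rfl
    ext x
    constructor
    · rintro ⟨u, hu, rfl⟩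
      rcases hcase u hu with ⟨j, p, rfl, hj, hu'⟩ | ⟨u, hu', rfl⟩
      · rw [hχ0 _ _ hj]; exact (e0 _).1 ⟨_, hu', rfl⟩
      · rw [hχ1 _ hu']; exact (e1 _).1 ⟨_, hu', rfl⟩
    · intro hx
      cases x with
      | nil => exact absurd hx hX
      | cons a x =>
        cases a with
        | zero =>
          obtain ⟨u, hu, rfl⟩ := (e0 _).2 hx
          cases u with
          | nil => exact absurd hu (nil_notMem_forestNodes _)
          | cons j p =>
            obtain ⟨hj, hu⟩ := mem_forestNodes_take.1 hu
            exact ⟨_, hu, hχ0 _ _ hj⟩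
        | succ a =>
          obtain ⟨u, hu, hux⟩ := (e1 (a :: x)).2 hx
          exact ⟨_, mem_forestNodes_drop.1 hu, by rw [hχ1 _ hu, hux]; rfl⟩

/-- The node sent to the root `[]` lies above all other nodes of the forest, so the forest has a
single tree and that node is its root. -/
theorem occurs_iff_of_nil_mem {σ : List PlaneTree} {X : Set (List ℕ)} (hX : [] ∈ X) :
    Occurs σ X ↔ ∃ ss, σ = [node ss] ∧ Occurs ss (X \ {[]}) := by
  constructor
  · rintro ⟨φ, hφ, rfl⟩
    obtain ⟨u, hu, hu0⟩ := hX
    have hpre : ∀ v ∈ forestNodes σ, u <+: v := fun v hv =>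
      (hφ.prefix_iff u hu v hv).1 (by rw [hu0]; simp)
    have h0 : ∀ i (h : i < σ.length), i = 0 := by
      intro i hi
      have hr : ∀ j < σ.length, u = [j] := by
        intro j hj
        have := hpre [j] (cons_mem_forestNodes.2 ⟨hj, isNode_nil _⟩)
        rcases List.prefix_cons_iff.1 this with h | ⟨t, h, ht⟩
        · exact absurd h hu.1
        · rw [h, List.prefix_nil.1 ht]
      have := (hr i hi).symm.trans (hr 0 (by omega))
      simpa using this
    match σ, hu, hpre, h0, hφ with
    | [], hu, _, _, _ =>
      cases u with
      | nil => exact absurd hu (nil_notMem_forestNodes _)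
      | cons j p => obtain ⟨h, -⟩ := cons_mem_forestNodes.1 hu; simp at h
    | _ :: _ :: _, _, _, h0, _ => exact absurd (h0 1 (by simp)) one_ne_zero
    | [node ss], hu, hpre, h0, hφ =>
      have hu' : u = [0] := by
        have := hpre [0] (cons_mem_forestNodes.2 ⟨by simp, isNode_nil _⟩)
        rcases List.prefix_cons_iff.1 this with h | ⟨t, h, ht⟩
        · exact absurd h hu.1
        · rw [h, List.prefix_nil.1 ht]
      subst hu'
      have hm : ∀ v ∈ forestNodes ss, 0 :: v ∈ forestNodes [node ss] := fun v hv =>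
        cons_mem_forestNodes.2 ⟨by simp, hv.2⟩
      refine ⟨ss, rfl, fun v => φ (0 :: v), ⟨fun v hv w hw => ?_, fun v hv w hw hvw => ?_⟩, ?_⟩
      · rw [hφ.prefix_iff _ (hm v hv) _ (hm w hw), List.cons_prefix_cons]; simp
      · exact hφ.leftOf _ (hm v hv) _ (hm w hw) (addrSibling_cons_cons.2 (Or.inr ⟨rfl, hvw⟩))
      · ext x
        constructor
        · rintro ⟨v, hv, rfl⟩
          refine ⟨⟨_, hm v hv, rfl⟩, fun h => ?_⟩
          have h' : φ (0 :: v) = [] := h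
          have := (hφ.prefix_iff _ (hm v hv) _ hu).1 (by rw [h']; simp)
          rw [List.cons_prefix_cons] at this
          exact hv.1 (List.prefix_nil.1 this.2)
        · rintro ⟨⟨v, hv, rfl⟩, hne⟩
          cases v with
          | nil => exact absurd hv (nil_notMem_forestNodes _)
          | cons j p =>
            obtain ⟨hj, hp⟩ := cons_mem_forestNodes.1 hv
            obtain rfl := h0 j hj
            refine ⟨p, ⟨?_, hp⟩, rfl⟩
            rintro rfl
            exact hne hu0
  · rintro ⟨ss, rfl, φ, hφ, hφX⟩
    have hne : ∀ u ∈ forestNodes ss, φ u ≠ [] := by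
      intro u hu h
      have : φ u ∈ X \ {[]} := hφX ▸ ⟨u, hu, rfl⟩
      exact this.2 h
    let χ : List ℕ → List ℕ := fun u => if u.tail = [] then [] else φ u.tail
    have hχ0 : χ [0] = [] := by simp [χ]
    have hχ1 : ∀ u ∈ forestNodes ss, χ (0 :: u) = φ u := fun u hu => by simp [χ, hu.1]
    have hcase : ∀ u ∈ forestNodes [node ss], u = [0] ∨ ∃ v ∈ forestNodes ss, u = 0 :: v := by
      intro u hu
      cases u with
      | nil => exact absurd hu (nil_notMem_forestNodes _)
      | cons j p =>
        obtain ⟨hj, hp⟩ := cons_mem_forestNodes.1 hu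
        obtain rfl : j = 0 := by simpa using hj
        by_cases h : p = []
        · left; rw [h]
        · exact Or.inr ⟨p, ⟨h, hp⟩, rfl⟩
    refine ⟨χ, ⟨fun u hu v hv => ?_, fun u hu v hv huv => ?_⟩, ?_⟩
    · rcases hcase u hu with rfl | ⟨u, hu', rfl⟩ <;> rcases hcase v hv with rfl | ⟨v, hv', rfl⟩
      · simp
      · simp [hχ0]
      · simp [hχ0, hχ1 u hu', hne u hu', hu'.1, List.cons_prefix_cons]
      · rw [hχ1 u hu', hχ1 v hv', hφ.prefix_iff u hu' v hv', List.cons_prefix_cons]; simp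
    · rcases hcase u hu with rfl | ⟨u, hu', rfl⟩ <;> rcases hcase v hv with rfl | ⟨v, hv', rfl⟩
      · simp [addrSibling_cons_cons, not_addrSibling_nil_left] at huv
      · simp [addrSibling_cons_cons, not_addrSibling_nil_left] at huv
      · simp [addrSibling_cons_cons, not_addrSibling_nil_right] at huv
      · rw [hχ1 u hu', hχ1 v hv']
        refine hφ.leftOf u hu' v hv' ?_
        simpa [addrSibling_cons_cons] using huv
    · ext x
      constructor
      · rintro ⟨u, hu, rfl⟩
        rcases hcase u hu with rfl | ⟨u, hu', rfl⟩
        · rwa [hχ0]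
        · rw [hχ1 u hu']
          have : φ u ∈ X \ {[]} := hφX ▸ ⟨u, hu', rfl⟩
          exact this.1
      · intro hx
        by_cases h : x = []
        · exact ⟨[0], cons_mem_forestNodes.2 ⟨by simp, isNode_nil _⟩, by rw [hχ0, h]⟩
        · have : x ∈ φ '' forestNodes ss := hφX ▸ ⟨hx, h⟩
          obtain ⟨u, hu, rfl⟩ := this
          exact ⟨0 :: u, cons_mem_forestNodes.2 ⟨by simp, hu.2⟩, hχ1 u hu⟩

/-! ### Counting forest embeddings: the recursion over the first subtree -/

/-- The addresses of the nodes of a tree. -/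
def addrs (T : PlaneTree) : Set (List ℕ) := {p | T.IsNode p}

theorem finite_addrs (T : PlaneTree) : T.addrs.Finite := finite_node T

theorem finite_forestNodes (σ : List PlaneTree) : (forestNodes σ).Finite :=
  (finite_addrs (node σ)).subset fun _ h => h.2

theorem IsForestMap.injOn {σ : List PlaneTree} {φ : List ℕ → List ℕ} (h : IsForestMap σ φ) :
    Set.InjOn φ (forestNodes σ) := by
  intro u hu v hv huv
  have h1 := (h.prefix_iff u hu v hv).1 (by rw [huv])
  have h2 := (h.prefix_iff v hv u hu).1 (by rw [huv])
  exact h1.eq_of_length (le_antisymm h1.length_le h2.length_le)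

theorem Occurs.ncard_eq {σ : List PlaneTree} {X : Set (List ℕ)} (h : Occurs σ X) :
    X.ncard = (forestNodes σ).ncard := by
  obtain ⟨φ, hφ, rfl⟩ := h
  exact hφ.injOn.ncard_image

theorem ncard_forestNodes_take_lt {σ : List PlaneTree} {k l : ℕ} (hkl : k < l)
    (hl : l ≤ σ.length) :
    (forestNodes (σ.take k)).ncard < (forestNodes (σ.take l)).ncard := by
  refine Set.ncard_lt_ncard ?_ (finite_forestNodes _)
  refine ⟨fun u hu => ?_, fun h => ?_⟩
  · cases u with
    | nil => exact absurd hu (nil_notMem_forestNodes _)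
    | cons j p =>
      obtain ⟨h1, h2⟩ := mem_forestNodes_take.1 hu
      exact mem_forestNodes_take.2 ⟨by omega, h2⟩
  · have := h (mem_forestNodes_take.2 ⟨hkl, cons_mem_forestNodes.2
      ⟨show k < σ.length by omega, isNode_nil _⟩⟩)
    exact lt_irrefl _ (mem_forestNodes_take.1 this).1

/-- Cardinality decides: an occurrence has as many elements as its forest has nodes, and longer
initial segments have strictly more. This makes the splitting index unique, so that the recursion is
a disjoint union. -/
theorem Occurs.take_unique {σ : List PlaneTree} {X : Set (List ℕ)} {k l : ℕ}
    (hk : k ≤ σ.length) (hl : l ≤ σ.length) (h : Occurs (σ.take k) X) (h' : Occurs (σ.take l) X) :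
    k = l := by
  have := h.ncard_eq.symm.trans h'.ncard_eq
  rcases lt_trichotomy k l with hlt | heq | hlt
  · exact absurd this (ncard_forestNodes_take_lt hlt hl).ne
  · exact heq
  · exact absurd this (ncard_forestNodes_take_lt hlt hk).ne'

theorem forestNodes_nil : forestNodes [] = ∅ := by
  ext p
  cases p with
  | nil => simp [nil_notMem_forestNodes]
  | cons i p => simp [cons_mem_forestNodes]

theorem occurs_nil {X : Set (List ℕ)} : Occurs [] X ↔ X = ∅ := by
  constructor
  · rintro ⟨φ, -, rfl⟩
    simp [forestNodes_nil]
  · rintro rfl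
    exact ⟨id, ⟨by simp [forestNodes_nil], by simp [forestNodes_nil]⟩, by simp [forestNodes_nil]⟩

theorem occurs_empty {σ : List PlaneTree} : Occurs σ ∅ ↔ σ = [] := by
  constructor
  · rintro ⟨φ, -, h⟩
    rw [Set.image_eq_empty] at h
    cases σ with
    | nil => rfl
    | cons s σ =>
      have : [0] ∈ forestNodes (s :: σ) := cons_mem_forestNodes.2 ⟨by simp, isNode_nil _⟩
      rw [h] at this
      exact absurd this (Set.notMem_empty _)
  · rintro rfl
    exact occurs_nil.2 rfl

/-- The embeddings of the forest `σ` into the tree `T`, as sets of addresses. -/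
def forestEmbeddings (σ : List PlaneTree) (T : PlaneTree) : Set (Set (List ℕ)) :=
  {X | X ⊆ T.addrs ∧ Occurs σ X}

/-- The embeddings of the forest `σ` into the tree `T` that avoid the root of `T`. -/
def properForestEmbeddings (σ : List PlaneTree) (T : PlaneTree) : Set (Set (List ℕ)) :=
  {X | X ∈ forestEmbeddings σ T ∧ [] ∉ X}

theorem finite_forestEmbeddings (σ : List PlaneTree) (T : PlaneTree) :
    (forestEmbeddings σ T).Finite :=
  T.finite_addrs.finite_subsets.subset fun _ h => h.1

theorem finite_properForestEmbeddings (σ : List PlaneTree) (T : PlaneTree) :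
    (properForestEmbeddings σ T).Finite :=
  (finite_forestEmbeddings σ T).subset fun _ h => h.1

/-- The number of embeddings of the forest `σ` into the tree `T`. -/
noncomputable def forestCount (σ : List PlaneTree) (T : PlaneTree) : ℕ :=
  (forestEmbeddings σ T).ncard

/-- The number of embeddings of the forest `σ` into the tree `T` that avoid the root of `T`. -/
noncomputable def properForestCount (σ : List PlaneTree) (T : PlaneTree) : ℕ :=
  (properForestEmbeddings σ T).ncard

theorem properForestCount_nil (T : PlaneTree) : properForestCount [] T = 1 := by
  have : properForestEmbeddings [] T = {∅} := by
    ext X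
    simp only [properForestEmbeddings, forestEmbeddings, occurs_nil, Set.mem_ofPred_eq,
      Set.mem_singleton_iff]
    constructor
    · rintro ⟨⟨-, h⟩, -⟩; exact h
    · rintro rfl; simp
  rw [properForestCount, this, Set.ncard_singleton]

theorem properForestCount_leaf {σ : List PlaneTree} (hσ : σ ≠ []) :
    properForestCount σ (node []) = 0 := by
  have : properForestEmbeddings σ (node []) = ∅ := by
    ext X
    simp only [Set.mem_empty_iff_false, iff_false]
    rintro ⟨⟨h1, h2⟩, h3⟩
    have : X = ∅ := by
      ext p
      simp only [Set.mem_empty_iff_false, iff_false]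
      intro hp
      cases p with
      | nil => exact h3 hp
      | cons i p => obtain ⟨h, -⟩ := isNode_cons.1 (h1 hp); simp at h
    rw [this, occurs_empty] at h2
    exact hσ h2
  rw [properForestCount, this, Set.ncard_empty]

theorem ncard_forestEmbeddings_nil_mem (ss : List PlaneTree) (T : PlaneTree) :
    {X | X ∈ forestEmbeddings [node ss] T ∧ [] ∈ X}.ncard = properForestCount ss T := by
  have : {X | X ∈ forestEmbeddings [node ss] T ∧ [] ∈ X} =
      insert [] '' properForestEmbeddings ss T := by
    ext X
    constructor
    · rintro ⟨⟨h1, h2⟩, h3⟩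
      obtain ⟨ss', h, h4⟩ := (occurs_iff_of_nil_mem h3).1 h2
      obtain rfl : ss = ss' := by simpa using h
      exact ⟨X \ {[]}, ⟨⟨Set.sdiff_subset.trans h1, h4⟩, by simp⟩, by simp [h3]⟩
    · rintro ⟨Y, ⟨⟨h1, h2⟩, h3⟩, rfl⟩
      refine ⟨⟨Set.insert_subset (isNode_nil T) h1, ?_⟩, by simp⟩
      exact (occurs_iff_of_nil_mem (by simp)).2 ⟨ss, rfl, by simpa [h3] using h2⟩
  rw [this, properForestCount]
  refine Set.InjOn.ncard_image fun X hX Y hY hXY => ?_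
  have := congrArg (· \ {[]}) hXY
  simpa [hX.2, hY.2] using this

theorem forestCount_eq_add (σ : List PlaneTree) (T : PlaneTree) :
    forestCount σ T =
      properForestCount σ T + {X | X ∈ forestEmbeddings σ T ∧ [] ∈ X}.ncard := by
  rw [forestCount, properForestCount, ← Set.ncard_union_eq _ (finite_properForestEmbeddings _ _)
    ((finite_forestEmbeddings σ T).subset fun _ h => h.1)]
  · congr 1
    ext X
    by_cases h : [] ∈ X <;> simp [properForestEmbeddings, h]
  · exact Set.disjoint_left.2 fun X h h' => h.2 h'.2

theorem forestCount_singleton (ss : List PlaneTree) (T : PlaneTree) :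
    forestCount [node ss] T = properForestCount [node ss] T + properForestCount ss T := by
  rw [forestCount_eq_add, ncard_forestEmbeddings_nil_mem]

theorem forestCount_of_length_ne_one {σ : List PlaneTree} (hσ : σ.length ≠ 1) (T : PlaneTree) :
    forestCount σ T = properForestCount σ T := by
  rw [forestCount_eq_add, Nat.add_eq_left, Set.ncard_eq_zero
    ((finite_forestEmbeddings σ T).subset fun _ h => h.1)]
  ext X
  simp only [Set.mem_empty_iff_false, iff_false]
  rintro ⟨h1, h2⟩
  obtain ⟨ss, rfl, -⟩ := (occurs_iff_of_nil_mem h2).1 h1.2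
  exact hσ rfl

/-- Put together a set of addresses of the first tree of a forest and one of the other trees. -/
def joinAddrs (Y Z : Set (List ℕ)) : Set (List ℕ) := List.cons 0 '' Y ∪ shift 1 '' Z

theorem preimage_cons_joinAddrs {Y Z : Set (List ℕ)} :
    List.cons 0 ⁻¹' joinAddrs Y Z = Y := by
  ext x
  simp only [joinAddrs, Set.mem_preimage, Set.mem_union, Set.mem_image]
  constructor
  · rintro (⟨y, hy, h⟩ | ⟨z, hz, h⟩)
    · simp at h; exact h ▸ hy
    · cases z <;> simp [shift] at h
  · exact fun h => Or.inl ⟨x, h, rfl⟩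

theorem shift_injective (k : ℕ) : Function.Injective (shift k) := by
  intro p q h
  cases p <;> cases q <;> simp_all [shift]

theorem preimage_shift_joinAddrs {Y Z : Set (List ℕ)} :
    shift 1 ⁻¹' joinAddrs Y Z = Z := by
  ext x
  simp only [joinAddrs, Set.mem_preimage, Set.mem_union, Set.mem_image]
  constructor
  · rintro (⟨y, hy, h⟩ | ⟨z, hz, h⟩)
    · cases x <;> simp [shift] at h
    · exact shift_injective 1 h ▸ hz
  · exact fun h => Or.inr ⟨x, h, rfl⟩

theorem joinAddrs_preimage {X : Set (List ℕ)} (hX : [] ∉ X) :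
    joinAddrs (List.cons 0 ⁻¹' X) (shift 1 ⁻¹' X) = X := by
  ext x
  simp only [joinAddrs, Set.mem_preimage, Set.mem_union, Set.mem_image]
  constructor
  · rintro (⟨y, hy, rfl⟩ | ⟨z, hz, rfl⟩)
    · exact hy
    · exact hz
  · intro hx
    match x, hx with
    | [], hx => exact absurd hx hX
    | 0 :: p, hx => exact Or.inl ⟨p, hx, rfl⟩
    | (a + 1) :: p, hx => exact Or.inr ⟨a :: p, hx, rfl⟩

theorem shift_one_mem_addrs {t : PlaneTree} {τ : List PlaneTree} {p : List ℕ} :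
    shift 1 p ∈ (node (t :: τ)).addrs ↔ p ∈ (node τ).addrs := by
  cases p with
  | nil => exact ⟨fun _ => isNode_nil (node τ), fun _ => isNode_nil (node (t :: τ))⟩
  | cons i p =>
    simp only [addrs, Set.mem_ofPred_eq, shift, isNode_cons, List.length_cons,
      List.getElem_cons_succ, add_lt_add_iff_right]

theorem cons_zero_mem_addrs {t : PlaneTree} {τ : List PlaneTree} {p : List ℕ} :
    0 :: p ∈ (node (t :: τ)).addrs ↔ p ∈ t.addrs := by
  simp [addrs, isNode_cons]

theorem joinAddrs_mem_properForestEmbeddings {σ τ : List PlaneTree} {t : PlaneTree} {k : ℕ}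
    {Y Z : Set (List ℕ)} (hY : Y ∈ forestEmbeddings (σ.take k) t)
    (hZ : Z ∈ properForestEmbeddings (σ.drop k) (node τ)) :
    joinAddrs Y Z ∈ properForestEmbeddings σ (node (t :: τ)) := by
  have hnil : [] ∉ joinAddrs Y Z := by
    rintro (⟨y, -, h⟩ | ⟨z, hz, h⟩)
    · simp at h
    · cases z with
      | nil => exact hZ.2 hz
      | cons => simp [shift] at h
  refine ⟨⟨?_, Occurs.of_split (k := k) hnil ?_ ?_⟩, hnil⟩
  · rintro x (⟨y, hy, rfl⟩ | ⟨z, hz, rfl⟩)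
    · exact cons_zero_mem_addrs.2 (hY.1 hy)
    · exact shift_one_mem_addrs.2 (hZ.1.1 hz)
  · rw [preimage_cons_joinAddrs]; exact hY.2
  · rw [preimage_shift_joinAddrs]; exact hZ.1.2

/-- The part in `t` may use the root of `t`, whereas the part in `node τ` must avoid its root, which
stands for the root of the whole tree; hence the two different counts. -/
theorem properForestCount_node_cons (σ : List PlaneTree) (t : PlaneTree) (τ : List PlaneTree) :
    properForestCount σ (node (t :: τ)) = ∑ k ∈ Finset.range (σ.length + 1),
      forestCount (σ.take k) t * properForestCount (σ.drop k) (node τ) := by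
  let B : ℕ → Set (Set (List ℕ) × Set (List ℕ)) := fun k =>
    forestEmbeddings (σ.take k) t ×ˢ properForestEmbeddings (σ.drop k) (node τ)
  have hinj : Function.Injective (fun P : Set (List ℕ) × Set (List ℕ) => joinAddrs P.1 P.2) := by
    rintro ⟨Y, Z⟩ ⟨Y', Z'⟩ h
    have h1 := congrArg (List.cons 0 ⁻¹' ·) h
    have h2 := congrArg (shift 1 ⁻¹' ·) h
    simp only [preimage_cons_joinAddrs, preimage_shift_joinAddrs] at h1 h2
    rw [h1, h2]
  have hset : properForestEmbeddings σ (node (t :: τ)) =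
      (fun P : Set (List ℕ) × Set (List ℕ) => joinAddrs P.1 P.2) ''
        ⋃ k ∈ (Finset.range (σ.length + 1) : Set ℕ), B k := by
    ext X
    simp only [Set.mem_image, Set.mem_iUnion]
    constructor
    · rintro ⟨⟨h1, h2⟩, h3⟩
      obtain ⟨k, hk, hk1, hk2⟩ := h2.exists_split h3
      refine ⟨(List.cons 0 ⁻¹' X, shift 1 ⁻¹' X), ⟨k, by simpa [Nat.lt_succ_iff] using hk,
        ⟨fun x hx => cons_zero_mem_addrs.1 (h1 hx), hk1⟩,
        ⟨fun x hx => shift_one_mem_addrs.1 (h1 hx), hk2⟩, h3⟩, joinAddrs_preimage h3⟩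
    · rintro ⟨⟨Y, Z⟩, ⟨k, -, hY, hZ⟩, rfl⟩
      exact joinAddrs_mem_properForestEmbeddings hY hZ
  rw [properForestCount, hset, Set.ncard_image_of_injective _ hinj,
    Set.Finite.ncard_biUnion (Finset.finite_toSet _), finsum_mem_coe_finset]
  · exact Finset.sum_congr rfl fun k _ => Set.ncard_prod
  · exact fun k _ => (finite_forestEmbeddings _ _).prod (finite_properForestEmbeddings _ _)
  · intro k hk l hl hkl
    refine Set.disjoint_left.2 ?_
    rintro ⟨Y, Z⟩ h h'
    simp only [Finset.coe_range, Set.mem_Iio] at hk hl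
    exact hkl (Occurs.take_unique (by omega) (by omega) h.1.2 h'.1.2)

/-! ### Embeddings of a tree as embeddings of a one-tree forest -/

theorem AddrLeftOf.lt_of_append {w : List ℕ} {i j : ℕ} (h : AddrLeftOf (w ++ [i]) (w ++ [j])) :
    i < j := by
  induction w with
  | nil => simpa [addrLeftOf_cons_cons, not_addrLeftOf_nil_left] using h
  | cons a w ih =>
    simp only [List.cons_append, addrLeftOf_cons_cons, lt_irrefl, true_and, false_or] at h
    exact ih h

theorem mem_forestNodes_singleton {S : PlaneTree} {u : List ℕ} :
    u ∈ forestNodes [S] ↔ ∃ p, S.IsNode p ∧ u = 0 :: p := by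
  cases u with
  | nil => simp [nil_notMem_forestNodes]
  | cons j p =>
    rw [cons_mem_forestNodes]
    constructor
    · rintro ⟨h, hp⟩
      obtain rfl : j = 0 := by simpa using h
      exact ⟨p, hp, rfl⟩
    · rintro ⟨q, hq, h⟩
      simp only [List.cons.injEq] at h
      obtain ⟨rfl, rfl⟩ := h
      exact ⟨by simp, hq⟩

theorem image_val_embeddings (S T : PlaneTree) :
    (fun X : Set T.Node => Subtype.val '' X) '' embeddings S T = forestEmbeddings [S] T := by
  have hsib : ∀ u v : S.Node, AddrSibling (0 :: u.1) (0 :: v.1) ↔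
      ∃ w : S.Node, w.IsChild u ∧ w.IsChild v ∧ u.LeftOf v := by
    intro u v
    rw [addrSibling_cons_cons]
    constructor
    · rintro (⟨h, -⟩ | ⟨-, w, i, j, hij, hu, hv⟩)
      · exact absurd h (lt_irrefl _)
      · exact ⟨⟨w, isNode_of_prefix ⟨[i], hu.symm⟩ u.2⟩, ⟨i, hu⟩, ⟨j, hv⟩,
          AddrSibling.addrLeftOf ⟨w, i, j, hij, hu, hv⟩⟩
    · rintro ⟨w, ⟨i, hi⟩, ⟨j, hj⟩, hl⟩
      have hl' : AddrLeftOf u.1 v.1 := hl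
      rw [hi, hj] at hl'
      exact Or.inr ⟨rfl, w.1, i, j, hl'.lt_of_append, hi, hj⟩
  ext X
  constructor
  · rintro ⟨_, ⟨φ, hφ, rfl⟩, rfl⟩
    refine ⟨?_, ?_⟩
    · rintro _ ⟨v, -, rfl⟩
      exact v.2
    · classical
      -- Nodes of the forest `[S]` carry a leading 0, which `tail` strips; the value `[]` elsewhere
      -- plays no role.
      let ψ : List ℕ → List ℕ := fun u => if h : S.IsNode u.tail then (φ ⟨u.tail, h⟩).1 else []
      have hψ : ∀ u : S.Node, ψ (0 :: u.1) = (φ u).1 := fun u => by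
        have : S.IsNode (0 :: u.1).tail := u.2
        simp only [ψ, this, dif_pos]
        rfl
      refine ⟨ψ, ⟨?_, ?_⟩, ?_⟩
      · intro u hu v hv
        obtain ⟨p, hp, rfl⟩ := mem_forestNodes_singleton.1 hu
        obtain ⟨q, hq, rfl⟩ := mem_forestNodes_singleton.1 hv
        rw [hψ ⟨p, hp⟩, hψ ⟨q, hq⟩, List.cons_prefix_cons]
        exact (hφ.ancestorEq_iff ⟨p, hp⟩ ⟨q, hq⟩).trans (by simp [Node.AncestorEq])
      · intro u hu v hv huv
        obtain ⟨p, hp, rfl⟩ := mem_forestNodes_singleton.1 hu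
        obtain ⟨q, hq, rfl⟩ := mem_forestNodes_singleton.1 hv
        rw [hψ ⟨p, hp⟩, hψ ⟨q, hq⟩]
        obtain ⟨w, h1, h2, h3⟩ := (hsib ⟨p, hp⟩ ⟨q, hq⟩).1 huv
        exact hφ.children_leftOf w _ _ h1 h2 h3
      · ext x
        constructor
        · rintro ⟨u, hu, rfl⟩
          obtain ⟨p, hp, rfl⟩ := mem_forestNodes_singleton.1 hu
          exact ⟨_, ⟨⟨p, hp⟩, rfl⟩, (hψ ⟨p, hp⟩).symm⟩
        · rintro ⟨_, ⟨u, rfl⟩, rfl⟩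
          exact ⟨0 :: u.1, mem_forestNodes_singleton.2 ⟨u.1, u.2, rfl⟩, hψ u⟩
  · rintro ⟨hX, ψ, hψ, rfl⟩
    have hm : ∀ u : S.Node, 0 :: u.1 ∈ forestNodes [S] := fun u =>
      mem_forestNodes_singleton.2 ⟨u.1, u.2, rfl⟩
    let φ : S.Node → T.Node := fun u => ⟨ψ (0 :: u.1), hX ⟨_, hm u, rfl⟩⟩
    refine ⟨Set.range φ, ⟨φ, ⟨fun u v => ?_, fun w u v h1 h2 h3 => ?_⟩, rfl⟩, ?_⟩
    · exact (hψ.prefix_iff _ (hm u) _ (hm v)).trans (by simp [List.cons_prefix_cons, Node.AncestorEq])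
    · exact hψ.leftOf _ (hm u) _ (hm v) ((hsib u v).2 ⟨w, h1, h2, h3⟩)
    · ext x
      constructor
      · rintro ⟨_, ⟨u, rfl⟩, rfl⟩
        exact ⟨_, hm u, rfl⟩
      · rintro ⟨u, hu, rfl⟩
        obtain ⟨p, hp, rfl⟩ := mem_forestNodes_singleton.1 hu
        exact ⟨_, ⟨⟨p, hp⟩, rfl⟩, rfl⟩

theorem image_val_injective (T : PlaneTree) :
    Function.Injective (fun X : Set T.Node => Subtype.val '' X) :=
  Set.image_injective.2 Subtype.val_injective

theorem numEmb_eq (S T : PlaneTree) : numEmb S T = forestCount [S] T := by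
  rw [numEmb, forestCount, ← image_val_embeddings,
    Set.ncard_image_of_injective _ (image_val_injective T)]

theorem numGoodEmb_eq (ss : List PlaneTree) (T : PlaneTree) :
    numGoodEmb (node ss) T = properForestCount ss T := by
  rw [numGoodEmb, ← ncard_forestEmbeddings_nil_mem, ← image_val_embeddings,
    ← Set.ncard_image_of_injective _ (image_val_injective T)]
  congr 1
  have hroot : ∀ X : Set T.Node, T.root ∈ X ↔ [] ∈ Subtype.val '' X := by
    intro X
    constructor
    · exact fun h => ⟨_, h, rfl⟩
    · rintro ⟨v, hv, h⟩
      have : v = T.root := Subtype.ext h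
      exact this ▸ hv
  ext X
  constructor
  · rintro ⟨Y, ⟨h1, h2⟩, rfl⟩
    exact ⟨⟨Y, h1, rfl⟩, (hroot Y).1 h2⟩
  · rintro ⟨⟨Y, h1, rfl⟩, h2⟩
    exact ⟨Y, ⟨h1, (hroot Y).2 h2⟩, rfl⟩

/-! ### Size and number of leaves grow under embedding -/

open PowerSeries

theorem leaves_pos : ∀ T : PlaneTree, 0 < T.leaves
  | node [] => by simp [leaves]
  | node (t :: ts) => by
    have := leaves_pos t
    rw [leaves]
    omega

/-- The maximum absorbs the case of a single node, putting both clauses of the definition into a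
form usable by linear arithmetic. -/
theorem leaves_node (ts : List PlaneTree) : (node ts).leaves = max 1 (ts.map leaves).sum := by
  cases ts with
  | nil => simp [leaves]
  | cons t ts =>
    have := leaves_pos t
    simp only [leaves, List.map_cons, List.sum_cons]
    omega

theorem size_node_cons (t : PlaneTree) (τ : List PlaneTree) :
    (node (t :: τ)).size = t.size + (node τ).size := by
  simp only [size, List.map_cons, List.sum_cons]
  omega

/-- A nonzero count forces a nonzero term of the recursion, so the bounds for the two parts of the
split add up; no injection between leaves is needed. -/
theorem le_of_properForestCount_ne_zero (n : ℕ) : ∀ (τ σ : List PlaneTree), (node τ).size ≤ n →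
    properForestCount σ (node τ) ≠ 0 →
      (σ.map leaves).sum ≤ (τ.map leaves).sum ∧ (σ.map size).sum ≤ (τ.map size).sum := by
  induction n with
  | zero =>
    intro τ σ h
    have := size_pos (node τ)
    omega
  | succ n ih =>
    intro τ σ hn h
    cases τ with
    | nil =>
      by_cases hσ : σ = []
      · simp [hσ]
      · exact absurd (properForestCount_leaf hσ) h
    | cons t τ =>
      rw [size_node_cons] at hn
      have h1 := size_pos t
      have h2 := size_pos (node τ)
      rw [properForestCount_node_cons] at h
      obtain ⟨k, -, hk⟩ := Finset.exists_ne_zero_of_sum_ne_zero h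
      obtain ⟨hk1, hk2⟩ := mul_ne_zero_iff.1 hk
      have hd := ih τ (σ.drop k) (by omega) hk2
      have ht : ((σ.take k).map leaves).sum ≤ t.leaves ∧ ((σ.take k).map size).sum ≤ t.size := by
        obtain ⟨ts⟩ := t
        have hl := leaves_node ts
        have hs : (node ts).size = 1 + (ts.map size).sum := by rw [size]
        have hproper : properForestCount (σ.take k) (node ts) ≠ 0 →
            ((σ.take k).map leaves).sum ≤ (node ts).leaves ∧
              ((σ.take k).map size).sum ≤ (node ts).size := fun h => by
          have := ih ts _ (by omega) h
          omega
        by_cases hlen : (σ.take k).length = 1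
        · obtain ⟨⟨ss⟩, hss⟩ := List.length_eq_one_iff.1 hlen
          rw [hss, forestCount_singleton] at hk1
          by_cases h0 : properForestCount ss (node ts) = 0
          · refine hproper ?_
            rw [hss]
            omega
          · have := ih ts ss (by omega) h0
            have hl' := leaves_node ss
            have hs' : (node ss).size = 1 + (ss.map size).sum := by rw [size]
            rw [hss]
            simp only [List.map_cons, List.map_nil, List.sum_cons, List.sum_nil]
            omega
        · rw [forestCount_of_length_ne_one hlen] at hk1
          exact hproper hk1
      have e1 := congrArg (fun l => (List.map leaves l).sum) (List.take_append_drop k σ)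
      have e2 := congrArg (fun l => (List.map size l).sum) (List.take_append_drop k σ)
      simp only [List.map_append, List.sum_append] at e1 e2
      simp only [List.map_cons, List.sum_cons]
      omega

theorem Embeds.leaves_le_and_size_le {S T : PlaneTree} (h : S.Embeds T) :
    S.leaves ≤ T.leaves ∧ S.size ≤ T.size := by
  have h1 : forestCount [S] T ≠ 0 := by
    rw [← numEmb_eq]
    exact Set.ncard_ne_zero_of_mem h.some_mem (Set.toFinite _)
  obtain ⟨ss⟩ := S
  obtain ⟨ts⟩ := T
  have hl := leaves_node ts
  have hs : (node ts).size = 1 + (ts.map size).sum := by rw [size]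
  have hl' := leaves_node ss
  have hs' : (node ss).size = 1 + (ss.map size).sum := by rw [size]
  rw [forestCount_singleton] at h1
  by_cases h0 : properForestCount ss (node ts) = 0
  · have := le_of_properForestCount_ne_zero _ ts [node ss] le_rfl (by omega)
    simp only [List.map_cons, List.map_nil, List.sum_cons, List.sum_nil] at this
    omega
  · have := le_of_properForestCount_ne_zero _ ts ss le_rfl h0
    omega

/-! ### Generating functions and the functional equations -/

theorem mem_family {n : ℕ} {T : PlaneTree} : T ∈ family n ↔ T.size = n := by
  simp [family]

/-- A tree other than the single node is uniquely a first subtree `t` together with the rest `τ`;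
the root is counted in `τ`, so sizes add exactly. -/
theorem sum_family (n : ℕ) (w : PlaneTree → ℝ) : ∑ T ∈ family n, w T =
    (if n = 1 then w (node []) else 0) + ∑ p ∈ Finset.HasAntidiagonal.antidiagonal n, ∑ t ∈ family p.1,
      ∑ τ ∈ family p.2, w (match τ with | node l => node (t :: l)) := by
  have : DecidableEq PlaneTree := Classical.decEq _
  have h1 : ∑ T ∈ (family n).filter (· = node []), w T = if n = 1 then w (node []) else 0 := by
    rw [Finset.filter_eq']
    simp only [mem_family, size, List.map_nil, List.sum_nil, add_zero, eq_comm (a := 1)]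
    split_ifs <;> simp
  rw [← Finset.sum_filter_add_sum_filter_not (family n) (· = node []), h1]
  congr 1
  simp_rw [← Finset.sum_product']
  rw [Finset.sum_sigma']
  symm
  refine Finset.sum_bij (fun x _ => match x.2.2 with | node l => node (x.2.1 :: l)) ?_ ?_ ?_ ?_
  · rintro ⟨⟨a, b⟩, t, ⟨l⟩⟩ h
    simp only [Finset.mem_sigma, Finset.HasAntidiagonal.mem_antidiagonal, Finset.mem_product, mem_family] at h
    simp only [Finset.mem_filter, mem_family, size_node_cons, node.injEq, reduceCtorEq,
      not_false_eq_true, and_true]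
    omega
  · rintro ⟨⟨a, b⟩, t, ⟨l⟩⟩ h ⟨⟨a', b'⟩, t', ⟨l'⟩⟩ h' e
    simp only [Finset.mem_sigma, Finset.HasAntidiagonal.mem_antidiagonal, Finset.mem_product, mem_family] at h h'
    simp only [node.injEq, List.cons.injEq] at e
    obtain ⟨rfl, rfl⟩ := e
    obtain ⟨-, rfl, rfl⟩ := h
    obtain ⟨-, rfl, rfl⟩ := h'
    rfl
  · rintro ⟨l⟩ h
    simp only [Finset.mem_filter, mem_family, node.injEq] at h
    cases l with
    | nil => exact absurd rfl h.2
    | cons t l =>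
      rw [size_node_cons] at h
      exact ⟨⟨(t.size, (node l).size), t, node l⟩, by simp [mem_family, h.1], rfl⟩
  · rintro ⟨⟨a, b⟩, t, ⟨l⟩⟩ h
    rfl

/-- The generating function of all trees, counted by size and weighted by `w`. -/
noncomputable def genFun (w : PlaneTree → ℕ) : PowerSeries ℝ :=
  PowerSeries.mk fun n => ∑ T ∈ family n, (w T : ℝ)

theorem genFun_add (v w : PlaneTree → ℕ) : genFun (fun T => v T + w T) = genFun v + genFun w := by
  ext n
  simp [genFun, Finset.sum_add_distrib]

theorem genFun_eq {w : PlaneTree → ℕ} {I : Finset ℕ} {u v : ℕ → PlaneTree → ℕ}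
    (h : ∀ t τ, w (node (t :: τ)) = ∑ i ∈ I, u i t * v i (node τ)) :
    genFun w = (w (node []) : PowerSeries ℝ) * X + ∑ i ∈ I, genFun (u i) * genFun (v i) := by
  ext n
  rw [genFun, coeff_mk, sum_family, map_add, map_sum, ← map_natCast (C : ℝ →+* PowerSeries ℝ),
    coeff_C_mul, coeff_X]
  congr 1
  · split_ifs <;> simp
  · simp_rw [coeff_mul, genFun, coeff_mk]
    rw [Finset.sum_comm]
    refine Finset.sum_congr rfl fun p _ => ?_
    simp_rw [Finset.sum_mul_sum]
    rw [Finset.sum_comm' (t' := family p.1) (s' := fun _ => I) (by simp)]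
    refine Finset.sum_congr rfl fun t _ => ?_
    rw [Finset.sum_comm' (t' := family p.2) (s' := fun _ => I) (by simp)]
    refine Finset.sum_congr rfl fun τ _ => ?_
    obtain ⟨l⟩ := τ
    rw [h]
    push_cast
    rfl

/-- The generating function of all planted plane trees. -/
noncomputable def treeSeries : PowerSeries ℝ := genFun fun _ => 1

/-- The power series `√(1 - 4X)`. -/
noncomputable def sqrtSeries : PowerSeries ℝ := 1 - 2 * treeSeries

theorem treeSeries_eq : treeSeries = X + treeSeries * treeSeries := by
  have := genFun_eq (w := fun _ => 1) (I := {0}) (u := fun _ _ => 1) (v := fun _ _ => 1)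
    (fun t τ => by simp)
  simpa [treeSeries] using this

theorem sqrtSeries_sq : sqrtSeries ^ 2 = 1 - 4 * X := by
  have := treeSeries_eq
  rw [sqrtSeries]
  linear_combination -4 * this

theorem constantCoeff_sqrtSeries : constantCoeff sqrtSeries = 1 := by
  have : family 0 = ∅ := by
    ext T
    have := size_pos T
    simp [mem_family]
    omega
  rw [sqrtSeries, map_sub, map_mul, treeSeries, genFun, ← coeff_zero_eq_constantCoeff_apply (mk _),
    coeff_mk, this]
  simp

/-- The generating function of embeddings of a forest that avoid the root. -/
noncomputable def forestSeries (σ : List PlaneTree) : PowerSeries ℝ :=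
  genFun (properForestCount σ)

theorem forestSeries_nil : forestSeries [] = treeSeries := by
  rw [forestSeries, treeSeries]
  congr 1
  ext T
  exact properForestCount_nil T

theorem genFun_forestCount_singleton (ss : List PlaneTree) :
    genFun (forestCount [node ss]) = forestSeries [node ss] + forestSeries ss := by
  rw [forestSeries, forestSeries, ← genFun_add]
  congr 1
  ext T
  exact forestCount_singleton ss T

theorem genFun_forestCount {σ : List PlaneTree} (hσ : σ.length ≠ 1) :
    genFun (forestCount σ) = forestSeries σ := by
  rw [forestSeries]
  congr 1
  ext T
  exact forestCount_of_length_ne_one hσ T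

/-- In the convolution for `node ss :: σ` the empty and the full initial segment each contribute
`treeSeries` times the unknown, which turns the left factor 1 into `sqrtSeries`. The product
`forestSeries ss * forestSeries σ` comes from the initial segment of length one, the only one that
can use the root of the first subtree. -/
theorem sqrtSeries_mul_forestSeries (ss σ : List PlaneTree) :
    sqrtSeries * forestSeries (node ss :: σ) = forestSeries ss * forestSeries σ +
      ∑ k ∈ Finset.range σ.length,
        forestSeries (node ss :: σ.take k) * forestSeries (σ.drop k) := by
  have h := genFun_eq (fun t τ => properForestCount_node_cons (node ss :: σ) t τ)
  rw [properForestCount_leaf (by simp), List.length_cons, Finset.sum_range_succ'] at h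
  simp only [List.take_zero, List.drop_zero, List.take_succ_cons, List.drop_succ_cons] at h
  rw [genFun_forestCount (by simp), forestSeries_nil] at h
  change forestSeries (node ss :: σ) = _ + (∑ k ∈ Finset.range (σ.length + 1),
    genFun (forestCount (node ss :: σ.take k)) * forestSeries (σ.drop k) +
      treeSeries * forestSeries (node ss :: σ)) at h
  have h2 : ∑ k ∈ Finset.range (σ.length + 1),
      genFun (forestCount (node ss :: σ.take k)) * forestSeries (σ.drop k) =
      forestSeries ss * forestSeries σ + ∑ k ∈ Finset.range (σ.length + 1),
        forestSeries (node ss :: σ.take k) * forestSeries (σ.drop k) := by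
    rw [Finset.sum_range_succ', Finset.sum_range_succ' _ σ.length]
    simp only [List.take_zero, List.drop_zero]
    have h3 : ∑ k ∈ Finset.range σ.length, genFun (forestCount (node ss :: σ.take (k + 1))) *
        forestSeries (σ.drop (k + 1)) = ∑ k ∈ Finset.range σ.length,
          forestSeries (node ss :: σ.take (k + 1)) * forestSeries (σ.drop (k + 1)) := by
      refine Finset.sum_congr rfl fun k hk => ?_
      rw [genFun_forestCount]
      simp only [Finset.mem_range] at hk
      simp only [List.length_cons, List.length_take]
      omega
    rw [genFun_forestCount_singleton, h3]
    ring
  rw [h2, Finset.sum_range_succ, List.take_length, List.drop_length, forestSeries_nil] at h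
  simp only [Nat.cast_zero, zero_mul, zero_add] at h
  rw [sqrtSeries]
  linear_combination h

/-! ### Laurent polynomials in √(1 - 4X) and pole orders -/

/-- `f * √(1 - 4X) ^ e` is a polynomial in `√(1 - 4X)` with constant term `c`. -/
def IsSqrtLaurent (f : PowerSeries ℝ) (e : ℕ) (c : ℝ) : Prop :=
  ∃ Q : Polynomial ℝ, Q.coeff 0 = c ∧ f * sqrtSeries ^ e = Polynomial.aeval sqrtSeries Q

namespace IsSqrtLaurent

variable {f g : PowerSeries ℝ} {d e : ℕ} {b c : ℝ}

theorem mul (hf : IsSqrtLaurent f d b) (hg : IsSqrtLaurent g e c) :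
    IsSqrtLaurent (f * g) (d + e) (b * c) := by
  obtain ⟨P, rfl, hP⟩ := hf
  obtain ⟨Q, rfl, hQ⟩ := hg
  exact ⟨P * Q, by simp [Polynomial.mul_coeff_zero], by rw [map_mul, ← hP, ← hQ]; ring⟩

theorem add (hf : IsSqrtLaurent f e b) (hg : IsSqrtLaurent g e c) :
    IsSqrtLaurent (f + g) e (b + c) := by
  obtain ⟨P, rfl, hP⟩ := hf
  obtain ⟨Q, rfl, hQ⟩ := hg
  exact ⟨P + Q, by simp, by rw [map_add, ← hP, ← hQ]; ring⟩

/-- Lets a term of lower order be added to terms of higher order, where it leaves the leading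
coefficient unchanged. -/
theorem succ (hf : IsSqrtLaurent f e c) : IsSqrtLaurent f (e + 1) 0 := by
  obtain ⟨P, rfl, hP⟩ := hf
  exact ⟨P * Polynomial.X, by simp, by
    rw [map_mul, ← hP, Polynomial.aeval_X]; ring⟩

theorem of_sqrtSeries_mul (hf : IsSqrtLaurent (sqrtSeries * f) e c) :
    IsSqrtLaurent f (e + 1) c := by
  obtain ⟨P, rfl, hP⟩ := hf
  exact ⟨P, rfl, by rw [← hP]; ring⟩

theorem sum {ι : Type*} {s : Finset ι} {f : ι → PowerSeries ℝ} {c : ι → ℝ}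
    (h : ∀ i ∈ s, IsSqrtLaurent (f i) e (c i)) :
    IsSqrtLaurent (∑ i ∈ s, f i) e (∑ i ∈ s, c i) := by
  classical
  induction s using Finset.induction_on with
  | empty => exact ⟨0, by simp, by simp⟩
  | insert a s ha ih =>
    rw [Finset.sum_insert ha, Finset.sum_insert ha]
    exact (h a (by simp)).add (ih fun i hi => h i (by simp [hi]))

end IsSqrtLaurent

theorem isSqrtLaurent_treeSeries : IsSqrtLaurent treeSeries 0 (1 / 2) := by
  refine ⟨Polynomial.C (1 / 2) * (1 - Polynomial.X), by simp, ?_⟩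
  have h2 : (algebraMap ℝ (PowerSeries ℝ) (1 / 2)) * 2 = 1 := by
    rw [← map_ofNat (algebraMap ℝ (PowerSeries ℝ)) 2, ← map_mul]
    norm_num
  rw [map_mul, map_sub, map_one, Polynomial.aeval_X, Polynomial.aeval_C, sqrtSeries]
  linear_combination (-treeSeries) * h2

/-- The order of the pole of `forestSeries σ` in terms of `√(1 - 4X)`. -/
def poleOrder (σ : List PlaneTree) : ℕ := (σ.map fun s => s.size + s.leaves).sum - 1

theorem two_le_size_add_leaves (s : PlaneTree) : 2 ≤ s.size + s.leaves := by
  have := size_pos s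
  have := leaves_pos s
  omega

/-- Truncated subtraction makes `poleOrder []` equal to 0, so the formula also covers the single
node. -/
theorem poleOrder_eq (ss : List PlaneTree) :
    poleOrder ss + 2 = (node ss).size + (node ss).leaves := by
  cases ss with
  | nil => simp [poleOrder, size, leaves]
  | cons s ss =>
    have := two_le_size_add_leaves s
    simp only [poleOrder, List.map_cons, List.sum_cons, List.sum_map_add, size, leaves]
    omega

theorem poleOrder_cons (ss σ : List PlaneTree) :
    poleOrder (node ss :: σ) = poleOrder ss + (σ.map fun s => s.size + s.leaves).sum + 1 := by
  have := poleOrder_eq ss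
  rw [poleOrder, List.map_cons, List.sum_cons]
  omega

theorem poleOrder_add_one {σ : List PlaneTree} (hσ : σ ≠ []) :
    poleOrder σ + 1 = (σ.map fun s => s.size + s.leaves).sum := by
  cases σ with
  | nil => exact absurd rfl hσ
  | cons s σ =>
    have := two_le_size_add_leaves s
    simp only [poleOrder, List.map_cons, List.sum_cons]
    omega

/-- Every forest on the right of `sqrtSeries_mul_forestSeries` is smaller, and all terms of top
order have positive leading coefficients, so nothing cancels. -/
theorem exists_isSqrtLaurent_forestSeries (n : ℕ) : ∀ σ : List PlaneTree, (node σ).size ≤ n →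
    ∃ c > 0, IsSqrtLaurent (forestSeries σ) (poleOrder σ) c := by
  induction n with
  | zero =>
    intro σ h
    have := size_pos (node σ)
    omega
  | succ n ih =>
    intro σ hn
    match σ, hn with
    | [], _ =>
      exact ⟨1 / 2, by norm_num, by rw [forestSeries_nil]; exact isSqrtLaurent_treeSeries⟩
    | node ss :: σ, hn =>
      rw [size_node_cons] at hn
      have hn1 := size_pos (node ss)
      have hn2 := size_pos (node σ)
      obtain ⟨a, ha, hfa⟩ := ih ss (by omega)
      obtain ⟨b, hb, hfb⟩ := ih σ (by omega)
      rw [poleOrder_cons]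
      -- For `σ = []` the sum is empty and the product of series gives the leading term. Otherwise
      -- each summand has order one more than that product, which then contributes 0 to the leading
      -- coefficient.
      by_cases hσ : σ = []
      · refine ⟨a * b, mul_pos ha hb, IsSqrtLaurent.of_sqrtSeries_mul ?_⟩
        rw [sqrtSeries_mul_forestSeries]
        subst hσ
        simpa [poleOrder] using hfa.mul hfb
      · have hterm : ∀ k ∈ Finset.range σ.length, ∃ c > 0, IsSqrtLaurent
            (forestSeries (node ss :: σ.take k) * forestSeries (σ.drop k))
            (poleOrder ss + (σ.map fun s => s.size + s.leaves).sum) c := by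
          intro k hk
          rw [Finset.mem_range] at hk
          have e1 := congrArg (fun l => (List.map size l).sum) (List.take_append_drop k σ)
          have e2 := congrArg (fun l => (List.map (fun s => s.size + s.leaves) l).sum)
            (List.take_append_drop k σ)
          simp only [List.map_append, List.sum_append] at e1 e2
          have hd : σ.drop k ≠ [] := by simpa using hk
          have hd1 := poleOrder_add_one hd
          have hd2 : 0 < ((σ.drop k).map size).sum := by
            have := length_le_sum_size (σ.drop k)
            rw [List.length_drop] at this
            omega
          obtain ⟨c, hc, hfc⟩ := ih (node ss :: σ.take k) (by
            rw [size_node_cons]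
            simp only [size] at hn ⊢
            omega)
          obtain ⟨d, hd0, hfd⟩ := ih (σ.drop k) (by
            simp only [size] at hn ⊢
            omega)
          refine ⟨c * d, mul_pos hc hd0, ?_⟩
          have := hfc.mul hfd
          rw [poleOrder_cons] at this
          convert! this using 1
          omega
        choose! c hc hfc using hterm
        refine ⟨0 + ∑ k ∈ Finset.range σ.length, c k, ?_, IsSqrtLaurent.of_sqrtSeries_mul ?_⟩
        · rw [zero_add]
          exact Finset.sum_pos hc (by simpa using hσ)
        · rw [sqrtSeries_mul_forestSeries]
          refine IsSqrtLaurent.add ?_ (IsSqrtLaurent.sum hfc)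
          have := (hfa.mul hfb).succ
          rwa [add_assoc, poleOrder_add_one hσ] at this

/-- The series equals `forestSeries ss` times (`treeSeries` + `sqrtSeries`)/`sqrtSeries`, and the
numerator has constant term 1/2 as a polynomial in `sqrtSeries`. -/
theorem IsSqrtLaurent.forestCount_singleton {ss : List PlaneTree} {e : ℕ} {c : ℝ}
    (h : IsSqrtLaurent (forestSeries ss) e c) :
    IsSqrtLaurent (genFun (forestCount [node ss])) (e + 1) (c / 2) := by
  refine IsSqrtLaurent.of_sqrtSeries_mul ?_
  have h1 := sqrtSeries_mul_forestSeries ss []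
  rw [forestSeries_nil] at h1
  simp only [List.length_nil, Finset.range_zero, Finset.sum_empty, add_zero] at h1
  have h2 : sqrtSeries * genFun (forestCount [node ss]) =
      forestSeries ss * (treeSeries + sqrtSeries) := by
    rw [genFun_forestCount_singleton, mul_add, h1]; ring
  have h3 : IsSqrtLaurent (treeSeries + sqrtSeries) 0 (1 / 2 + 0) :=
    isSqrtLaurent_treeSeries.add ⟨Polynomial.X, by simp, by simp⟩
  rw [h2]
  convert! h.mul h3 using 1
  ring

/-! ### Asymptotics of the coefficients -/

/-- The power series `1 / √(1 - 4X)`. -/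
noncomputable def invSqrtSeries : PowerSeries ℝ := sqrtSeries⁻¹

theorem sqrtSeries_mul_invSqrtSeries : sqrtSeries * invSqrtSeries = 1 :=
  PowerSeries.mul_inv_cancel _ (by rw [constantCoeff_sqrtSeries]; exact one_ne_zero)

theorem constantCoeff_invSqrtSeries : constantCoeff invSqrtSeries = 1 := by
  have := congrArg constantCoeff sqrtSeries_mul_invSqrtSeries
  rwa [map_mul, constantCoeff_sqrtSeries, one_mul, map_one] at this

theorem one_sub_mul_derivative_invSqrtSeries :
    (1 - 4 * X) * derivative ℝ invSqrtSeries = 2 * invSqrtSeries := by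
  have h1 := congrArg (derivative ℝ) sqrtSeries_mul_invSqrtSeries
  have h2 := congrArg (derivative ℝ) sqrtSeries_sq
  have h4 : derivative ℝ (4 : PowerSeries ℝ) = 0 := by
    rw [← map_ofNat (C : ℝ →+* PowerSeries ℝ) 4]; exact derivative_C
  rw [pow_two] at h2
  simp only [Derivation.leibniz, smul_eq_mul, map_sub, derivative_one, h4, derivative_X] at h1 h2
  have h3 := sqrtSeries_mul_invSqrtSeries
  have h5 : sqrtSeries * derivative ℝ sqrtSeries = -2 := by
    have h2' : (2 : PowerSeries ℝ) * (sqrtSeries * derivative ℝ sqrtSeries) = 2 * (-2) := by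
      linear_combination h2
    have : (2 : PowerSeries ℝ) ≠ 0 := by
      rw [← map_ofNat (C : ℝ →+* PowerSeries ℝ) 2]
      intro h
      have := congrArg constantCoeff h
      simp at this
    exact mul_left_cancel₀ this h2'
  rw [← sqrtSeries_sq]
  linear_combination sqrtSeries * h1 - invSqrtSeries * h5

/-- This differential equation yields a first-order recurrence for the coefficients, hence the
binomial series without a general binomial theorem. -/
theorem one_sub_mul_derivative_pow (j : ℕ) :
    (1 - 4 * X) * derivative ℝ (invSqrtSeries ^ j) = 2 * (j : PowerSeries ℝ) * invSqrtSeries ^ j := by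
  induction j with
  | zero => simp
  | succ j ih =>
    rw [pow_succ, Derivation.leibniz, smul_eq_mul, smul_eq_mul]
    push_cast
    linear_combination invSqrtSeries * ih +
      invSqrtSeries ^ j * one_sub_mul_derivative_invSqrtSeries

theorem coeff_X_mul_derivative (f : PowerSeries ℝ) (n : ℕ) :
    coeff n (X * derivative ℝ f) = n * coeff n f := by
  cases n with
  | zero => simp
  | succ n => rw [coeff_succ_X_mul, coeff_derivative]; push_cast; ring

theorem coeff_invSqrtSeries_pow_succ (j n : ℕ) :
    coeff (n + 1) (invSqrtSeries ^ j) * (n + 1) =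
      4 * ((j : ℝ) / 2 + n) * coeff n (invSqrtSeries ^ j) := by
  have h := congrArg (coeff n) (one_sub_mul_derivative_pow j)
  have h1 : (1 - 4 * X) * derivative ℝ (invSqrtSeries ^ j) =
      derivative ℝ (invSqrtSeries ^ j) - C (4 : ℝ) * (X * derivative ℝ (invSqrtSeries ^ j)) := by
    rw [map_ofNat]; ring
  have h2 : 2 * (j : PowerSeries ℝ) * invSqrtSeries ^ j =
      C (2 * (j : ℝ)) * invSqrtSeries ^ j := by
    rw [map_mul, map_ofNat, map_natCast]
  rw [h1, h2, map_sub, coeff_C_mul, coeff_C_mul, coeff_X_mul_derivative, coeff_derivative] at h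
  linear_combination h

theorem coeff_invSqrtSeries_pow (j n : ℕ) :
    coeff n (invSqrtSeries ^ j) * (n.factorial : ℝ) =
      4 ^ n * ∏ i ∈ Finset.range n, ((j : ℝ) / 2 + i) := by
  induction n with
  | zero => simp [constantCoeff_invSqrtSeries]
  | succ n ih =>
    rw [Nat.factorial_succ, Finset.prod_range_succ]
    push_cast
    linear_combination (n.factorial : ℝ) * coeff_invSqrtSeries_pow_succ j n +
      4 * ((j : ℝ) / 2 + n) * ih

/-- The coefficients of `f`, divided by `4 ^ n * n ^ (-a)`, tend to `L`. -/
def HasCoeffLimit (f : PowerSeries ℝ) (a L : ℝ) : Prop :=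
  Tendsto (fun n : ℕ => coeff n f / 4 ^ n * (n : ℝ) ^ a) atTop (𝓝 L)

/-- With s = j/2, the normalised coefficient is (n/(n+s)) divided by Euler's sequence `Real.GammaSeq
s n`, which tends to Γ(s). -/
theorem hasCoeffLimit_invSqrtSeries_pow {j : ℕ} (hj : 0 < j) :
    HasCoeffLimit (invSqrtSeries ^ j) (1 - (j : ℝ) / 2) (1 / Real.Gamma ((j : ℝ) / 2)) := by
  have hs : 0 < (j : ℝ) / 2 := by positivity
  set s : ℝ := (j : ℝ) / 2
  have h1 : Tendsto (fun n : ℕ => (n : ℝ) / (n + s)) atTop (𝓝 1) :=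
    tendsto_natCast_div_add_atTop s
  have h2 := h1.div (Real.GammaSeq_tendsto_Gamma s) (Real.Gamma_pos_of_pos hs).ne'
  refine h2.congr' ?_
  filter_upwards [eventually_ge_atTop 1] with n hn
  have hn' : (0 : ℝ) < n := by exact_mod_cast hn
  have hc := coeff_invSqrtSeries_pow j n
  have hP : 0 < ∏ i ∈ Finset.range n, (s + i) := Finset.prod_pos fun i _ => by positivity
  have hf : (0 : ℝ) < n.factorial := by exact_mod_cast n.factorial_pos
  have hc' : coeff n (invSqrtSeries ^ j) / 4 ^ n =
      (∏ i ∈ Finset.range n, (s + i)) / n.factorial := by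
    rw [div_eq_div_iff (by positivity) hf.ne', hc]
    ring
  have hp : (0 : ℝ) < (n : ℝ) ^ s := Real.rpow_pos_of_pos hn' s
  have hsn : 0 < s + n := by positivity
  rw [Pi.div_apply, hc', Real.GammaSeq, Finset.prod_range_succ, Real.rpow_sub hn', Real.rpow_one,
    add_comm (n : ℝ) s]
  field_simp

/-- Coefficient n + 1 of the product is the difference of two terms with the same leading
asymptotics. -/
theorem HasCoeffLimit.one_sub_mul {f : PowerSeries ℝ} {a L : ℝ} (h : HasCoeffLimit f a L) :
    HasCoeffLimit ((1 - 4 * X) * f) a 0 := by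
  have hx : Tendsto (fun n : ℕ => ((n : ℝ) / (n + 1)) ^ (-a)) atTop (𝓝 1) := by
    have := (tendsto_natCast_div_add_atTop (1 : ℝ)).rpow_const (p := -a) (Or.inl one_ne_zero)
    rwa [Real.one_rpow] at this
  rw [HasCoeffLimit, ← tendsto_add_atTop_iff_nat 1]
  have h1 := ((tendsto_add_atTop_iff_nat 1).2 h).sub (h.mul hx)
  rw [mul_one, sub_self] at h1
  refine h1.congr' ?_
  filter_upwards [eventually_ge_atTop 1] with n hn
  have hn' : (0 : ℝ) < n := by exact_mod_cast hn
  have h2 : coeff (n + 1) ((1 - 4 * X) * f) = coeff (n + 1) f - 4 * coeff n f := by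
    rw [show (1 - 4 * X) * f = f - C (4 : ℝ) * (X * f) by rw [map_ofNat]; ring, map_sub,
      coeff_C_mul, coeff_succ_X_mul]
  have h3 : (n : ℝ) ^ a * ((n : ℝ) / (n + 1)) ^ (-a) = (n + 1 : ℝ) ^ a := by
    rw [Real.rpow_neg (by positivity), Real.div_rpow hn'.le (by positivity)]
    have := (Real.rpow_pos_of_pos hn' a).ne'
    have : (n + 1 : ℝ) ^ a ≠ 0 := (Real.rpow_pos_of_pos (by positivity) a).ne'
    field_simp
  rw [h2, mul_assoc, h3, pow_succ]
  push_cast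
  ring

theorem HasCoeffLimit.of_lt {f : PowerSeries ℝ} {a b L : ℝ} (h : HasCoeffLimit f a L)
    (hab : b < a) : HasCoeffLimit f b 0 := by
  have h1 := h.mul ((tendsto_rpow_neg_atTop (sub_pos.2 hab)).comp tendsto_natCast_atTop_atTop)
  rw [mul_zero] at h1
  refine h1.congr' ?_
  filter_upwards [eventually_ge_atTop 1] with n hn
  have hn' : (0 : ℝ) < n := by exact_mod_cast hn
  rw [Function.comp_apply, mul_assoc, ← Real.rpow_add hn']
  ring_nf

theorem hasCoeffLimit_one (a : ℝ) : HasCoeffLimit 1 a 0 := by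
  refine (tendsto_const_nhds (x := (0 : ℝ))).congr' ?_
  filter_upwards [eventually_ge_atTop 1] with n hn
  rw [coeff_one, if_neg (by omega)]
  simp

/-- Steps of two in `i` multiply by 1 - 4X, which kills the limit, so positive powers of √(1 - 4X)
need no separate expansion. For `i = 1` one factor cancels and the growth exponent drops by 1/2, or
the series becomes 1. -/
theorem hasCoeffLimit_sqrtSeries_pow_mul {j : ℕ} (hj : 0 < j) (i : ℕ) :
    HasCoeffLimit (sqrtSeries ^ i * invSqrtSeries ^ j) (1 - (j : ℝ) / 2)
      (if i = 0 then 1 / Real.Gamma ((j : ℝ) / 2) else 0) := by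
  induction i using Nat.twoStepInduction with
  | zero => simpa using hasCoeffLimit_invSqrtSeries_pow hj
  | one =>
    obtain ⟨j, rfl⟩ := Nat.exists_eq_succ_of_ne_zero hj.ne'
    have h1 : sqrtSeries ^ 1 * invSqrtSeries ^ (j + 1) = invSqrtSeries ^ j := by
      linear_combination invSqrtSeries ^ j * sqrtSeries_mul_invSqrtSeries
    rw [Nat.succ_eq_add_one, h1, if_neg one_ne_zero]
    rcases Nat.eq_zero_or_pos j with rfl | hj'
    · rw [pow_zero]
      exact hasCoeffLimit_one _
    · refine (hasCoeffLimit_invSqrtSeries_pow hj').of_lt ?_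
      push_cast
      linarith
  | more i ih _ =>
    rw [if_neg (by omega), pow_add, mul_comm (sqrtSeries ^ i), sqrtSeries_sq, mul_assoc]
    exact ih.one_sub_mul

theorem IsSqrtLaurent.hasCoeffLimit {f : PowerSeries ℝ} {e : ℕ} {c : ℝ} (he : 0 < e)
    (h : IsSqrtLaurent f e c) :
    HasCoeffLimit f (1 - (e : ℝ) / 2) (c / Real.Gamma ((e : ℝ) / 2)) := by
  obtain ⟨Q, rfl, hQ⟩ := h
  have hf : f = ∑ i ∈ Finset.range (Q.natDegree + 1),
      C (Q.coeff i) * (sqrtSeries ^ i * invSqrtSeries ^ e) := by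
    have h1 : f = Polynomial.aeval sqrtSeries Q * invSqrtSeries ^ e := by
      rw [← hQ, mul_assoc, ← mul_pow, sqrtSeries_mul_invSqrtSeries, one_pow, mul_one]
    rw [h1, Polynomial.aeval_eq_sum_range, Finset.sum_mul]
    refine Finset.sum_congr rfl fun i _ => ?_
    rw [PowerSeries.smul_eq_C_mul, mul_assoc]
  have h2 := tendsto_finsetSum (Finset.range (Q.natDegree + 1)) fun i _ =>
    (hasCoeffLimit_sqrtSeries_pow_mul he i).const_mul (Q.coeff i)
  have h3 : ∑ i ∈ Finset.range (Q.natDegree + 1), Q.coeff i *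
      (if i = 0 then 1 / Real.Gamma ((e : ℝ) / 2) else 0) =
        Q.coeff 0 / Real.Gamma ((e : ℝ) / 2) := by
    simp [div_eq_mul_inv]
  rw [h3] at h2
  refine h2.congr fun n => ?_
  conv_rhs => rw [hf]
  rw [map_sum, Finset.sum_div, Finset.sum_mul]
  refine Finset.sum_congr rfl fun i _ => ?_
  rw [coeff_C_mul]
  ring

/-! ### Limits of the scaled ratio -/

theorem familyNumGoodEmb_eq (ss : List PlaneTree) (n : ℕ) :
    (familyNumGoodEmb n (node ss) : ℝ) = coeff n (forestSeries ss) := by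
  simp [familyNumGoodEmb, forestSeries, genFun, numGoodEmb_eq]

theorem familyNumEmb_eq (S : PlaneTree) (n : ℕ) :
    (familyNumEmb n S : ℝ) = coeff n (genFun (forestCount [S])) := by
  simp [familyNumEmb, genFun, numEmb_eq]

theorem tendsto_scaledRatio {ss : List PlaneTree} (h : 0 < poleOrder ss) :
    Tendsto (node ss).scaledRatio atTop (𝓝 (2 * Real.Gamma (((poleOrder ss + 1 : ℕ) : ℝ) / 2) /
      Real.Gamma ((poleOrder ss : ℝ) / 2))) := by
  obtain ⟨c, hc, hf⟩ := exists_isSqrtLaurent_forestSeries _ ss le_rfl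
  have hg := hf.forestCount_singleton
  have hG0 : 0 < Real.Gamma ((poleOrder ss : ℝ) / 2) := Real.Gamma_pos_of_pos (by positivity)
  have hG1 : 0 < Real.Gamma (((poleOrder ss + 1 : ℕ) : ℝ) / 2) :=
    Real.Gamma_pos_of_pos (by positivity)
  have h1 := (hf.hasCoeffLimit h).div (hg.hasCoeffLimit (Nat.succ_pos _))
    (div_pos (half_pos hc) hG1).ne'
  have h2 : c / Real.Gamma ((poleOrder ss : ℝ) / 2) /
      (c / 2 / Real.Gamma (((poleOrder ss + 1 : ℕ) : ℝ) / 2)) =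
      2 * Real.Gamma (((poleOrder ss + 1 : ℕ) : ℝ) / 2) / Real.Gamma ((poleOrder ss : ℝ) / 2) := by
    field_simp
  rw [h2] at h1
  refine h1.congr' ?_
  filter_upwards [eventually_ge_atTop 1] with n hn
  have hn' : (0 : ℝ) < n := by exact_mod_cast hn
  rw [Pi.div_apply, scaledRatio, familyNumGoodEmb_eq, familyNumEmb_eq, Real.sqrt_eq_rpow,
    mul_div_mul_comm, div_div_div_cancel_right₀ (by positivity), ← Real.rpow_sub hn', mul_comm]
  congr 2
  push_cast
  ring

/-- A single node can be placed at each node but the root. This serves the case m = 1, where the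
pole order is 0 and the coefficient asymptotics do not apply. -/
theorem properForestCount_singleton_leaf (n : ℕ) : ∀ τ : List PlaneTree, (node τ).size ≤ n →
    properForestCount [node []] (node τ) + 1 = (node τ).size := by
  induction n with
  | zero =>
    intro τ h
    have := size_pos (node τ)
    omega
  | succ n ih =>
    intro τ hn
    cases τ with
    | nil => rw [properForestCount_leaf (by simp)]; simp [size]
    | cons t τ =>
      rw [size_node_cons] at hn ⊢
      have h1 := size_pos t
      have h2 := size_pos (node τ)
      obtain ⟨ts⟩ := t
      have h3 := ih ts (by omega)
      have h4 := ih τ (by omega)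
      rw [properForestCount_node_cons]
      simp only [List.length_singleton, Finset.sum_range_succ, Finset.range_zero, Finset.sum_empty,
        List.take_zero, List.drop_zero, List.take_succ_cons, List.drop_succ_cons, List.drop_nil,
        List.take_nil, forestCount_singleton, properForestCount_nil,
        forestCount_of_length_ne_one (σ := []) (by simp)]
      omega

theorem familyNumEmb_leaf (n : ℕ) :
    familyNumEmb n (node []) = n * familyNumGoodEmb n (node []) := by
  rw [familyNumEmb, familyNumGoodEmb, Finset.mul_sum]
  refine Finset.sum_congr rfl fun T hT => ?_
  obtain ⟨τ⟩ := T
  rw [numEmb_eq, numGoodEmb_eq, forestCount_singleton, properForestCount_nil,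
    properForestCount_singleton_leaf _ τ le_rfl, mem_family.1 hT, mul_one]

theorem tendsto_scaledRatio_leaf : Tendsto (node []).scaledRatio atTop (𝓝 0) := by
  have h : Tendsto (fun n : ℕ => (√(n : ℝ))⁻¹) atTop (𝓝 0) :=
    tendsto_inv_atTop_zero.comp (Real.tendsto_sqrt_atTop.comp tendsto_natCast_atTop_atTop)
  refine squeeze_zero' (Eventually.of_forall fun n => ?_) ?_ h
  · rw [scaledRatio]; positivity
  · filter_upwards [eventually_ge_atTop 1] with n hn
    have hn' : (0 : ℝ) < n := by exact_mod_cast hn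
    rw [scaledRatio, familyNumEmb_leaf]
    by_cases hg : (familyNumGoodEmb n (node []) : ℝ) = 0
    · rw [hg, zero_div, mul_zero]; positivity
    · push_cast
      rw [div_mul_cancel_right₀ hg, ← div_eq_mul_inv, Real.sqrt_div_self']
      simp

theorem poleOrder_cons_pos (s : PlaneTree) (ss : List PlaneTree) : 0 < poleOrder (s :: ss) := by
  have := two_le_size_add_leaves s
  simp only [poleOrder, List.map_cons, List.sum_cons]
  omega

theorem size_eq_one {S : PlaneTree} (h : S.size = 1) : S = node [] := by
  obtain ⟨_ | ⟨s, ss⟩⟩ := S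
  · rfl
  · have := size_pos s
    have := size_pos (node ss)
    rw [size_node_cons] at h
    omega

/-- The limit of `scaledRatio`, in terms of `poleOrder`. -/
noncomputable def limitRatio (e : ℕ) : ℝ :=
  2 * Real.Gamma (((e + 1 : ℕ) : ℝ) / 2) / Real.Gamma ((e : ℝ) / 2)

theorem tendsto_scaledRatio_limitRatio (ss : List PlaneTree) :
    Tendsto (node ss).scaledRatio atTop (𝓝 (limitRatio (poleOrder ss))) := by
  cases ss with
  | nil =>
    -- The convention Γ(0) = 0, together with division by zero being 0, gives the correct limit for
    -- the single node.
    have : limitRatio (poleOrder []) = 0 := by simp [limitRatio, poleOrder, Real.Gamma_zero]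
    rw [this]
    exact tendsto_scaledRatio_leaf
  | cons s ss => exact tendsto_scaledRatio (poleOrder_cons_pos s ss)

/-- For e > 0 the inequality between e and e + 1 reads Γ((e+1)/2)² ≤ Γ(e/2)·Γ((e+2)/2), which is
log-convexity of Γ at a midpoint. -/
theorem limitRatio_monotone : Monotone limitRatio := by
  refine monotone_nat_of_le_succ fun e => ?_
  rcases Nat.eq_zero_or_pos e with rfl | he
  · have : limitRatio 0 = 0 := by simp [limitRatio, Real.Gamma_zero]
    rw [this, limitRatio]
    have h1 := Real.Gamma_pos_of_pos (show 0 < ((0 + 1 : ℕ) : ℝ) / 2 by norm_num)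
    have h2 := Real.Gamma_pos_of_pos (show 0 < ((0 + 1 + 1 : ℕ) : ℝ) / 2 by norm_num)
    positivity
  · have hx : 0 < (e : ℝ) / 2 := by positivity
    have hz : 0 < ((e + 1 + 1 : ℕ) : ℝ) / 2 := by positivity
    have h0 := Real.Gamma_pos_of_pos hx
    have h1 := Real.Gamma_pos_of_pos (show 0 < ((e + 1 : ℕ) : ℝ) / 2 by positivity)
    have h2 := Real.Gamma_pos_of_pos hz
    have key := Real.Gamma_mul_add_mul_le_rpow_Gamma_mul_rpow_Gamma hx hz
      (show (0 : ℝ) < 1 / 2 by norm_num) (show (0 : ℝ) < 1 / 2 by norm_num) (by norm_num)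
    rw [← Real.mul_rpow h0.le h2.le, ← Real.sqrt_eq_rpow,
      show 1 / 2 * ((e : ℝ) / 2) + 1 / 2 * (((e + 1 + 1 : ℕ) : ℝ) / 2) = ((e + 1 : ℕ) : ℝ) / 2 by
        push_cast; ring, Real.le_sqrt h1.le (by positivity)] at key
    rw [limitRatio, limitRatio, div_le_div_iff₀ h0 h1]
    linarith

end PlaneTree

theorem mainTheorem10 :
    (∀ S : PlaneTree, 1 < S.size → ∀ k : ℝ, k = ((S.size : ℝ) + (S.leaves : ℝ) - 2) / 2 →
      Tendsto S.scaledRatio atTop (𝓝 (2 * Real.Gamma (k + 1 / 2) / Real.Gamma k))) ∧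
    (∀ S : PlaneTree, S.size = 1 → Tendsto S.scaledRatio atTop (𝓝 0)) ∧
    (∀ S₁ S₂ : PlaneTree, S₁.Embeds S₂ →
      ∃ L₁ L₂ : ℝ, Tendsto S₁.scaledRatio atTop (𝓝 L₁) ∧
        Tendsto S₂.scaledRatio atTop (𝓝 L₂) ∧ L₁ ≤ L₂) := by
  refine ⟨?_, ?_, ?_⟩
  · rintro ⟨ss⟩ - k rfl
    have h : ((PlaneTree.node ss).size : ℝ) + (PlaneTree.node ss).leaves = (PlaneTree.poleOrder ss : ℝ) + 2 := by
      exact_mod_cast (PlaneTree.poleOrder_eq ss).symm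
    have h1 : ((PlaneTree.poleOrder ss + 1 : ℕ) : ℝ) / 2 = (PlaneTree.poleOrder ss : ℝ) / 2 + 1 / 2 := by
      push_cast; ring
    have := PlaneTree.tendsto_scaledRatio_limitRatio ss
    rw [PlaneTree.limitRatio, h1] at this
    rwa [h, add_sub_cancel_right]
  · intro S hS
    rw [PlaneTree.size_eq_one hS]
    exact PlaneTree.tendsto_scaledRatio_leaf
  · rintro ⟨ss⟩ ⟨ts⟩ h
    refine ⟨_, _, PlaneTree.tendsto_scaledRatio_limitRatio ss, PlaneTree.tendsto_scaledRatio_limitRatio ts,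
      PlaneTree.limitRatio_monotone ?_⟩
    have h1 := PlaneTree.poleOrder_eq ss
    have h2 := PlaneTree.poleOrder_eq ts
    have h3 := h.leaves_le_and_size_le
    omega
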